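/- Let $K$ be a field, $S=K[x_1,\ldots,x_n]$ with the standard grading, and $A=K[x_1,\ldots,x_n,y_1,\ldots,y_m]$ with the bigrading $\deg x_i=(1,0)$, $\deg y_j=(p_j,1)$, where the $p_j\geq 0$ are integers. For a bigraded $A$-module $X=\bigoplus_{c,k\in\mathbb Z}X_{(c,k)}$ let $X_k=\bigoplus_{c}X_{(c,k)}$, which is a graded $S$-module. Let $M$ be a finitely generated graded $S$-module and $N$ a finitely generated bigraded $A$-module. Let $\operatorname{Tor}_i^S(M,N)$ carry its natural bigrading, that is, the one of $H_i(M\otimes_S F)$ for a bigraded free $A$-resolution $F$ of $N$. Let $\dim$ denote the Krull dimension of an $S$-module, with $\dim 0=-\infty$. Then: (1) $\dim \operatorname{Tor}_{i+1}^S(M,N)_k\leq \dim \operatorname{Tor}_i^S(M,N)_k$ for all $i\geq 0$ and all $k$. (2) In particular, $\dim \operatorname{Tor}_{i}^S(M,N)_k\leq \dim (M\otimes_S N_k)$ for all $i\geq 0$ and all $k$. (3) Hence the following holds. The dimension $\dim(M\otimes_S N_k)$ has a constant value $d$ for $k\gg 0$. For a finitely generated graded $S$-module $U$ put $H_0(U,t)=\dim_K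 U_t$ and $H_{j+1}(U,t)=\sum_{s\leq t}H_{j}(U,s)$; the $j$-th iterated Hilbert polynomial of $U$ is the polynomial $P\in\mathbb Q[t]$ with $H_j(U,t)=P(t)$ for all $t\gg 0$. There is a $k_0$ such that for all $k\geq k_0$ and all $i,j\geq 0$ the $j$-th iterated Hilbert polynomial of $\operatorname{Tor}_i^S(M,N)_k$ exists and has degree at most $d+j-1$ (where the zero polynomial has degree $-\infty$). -/

import Mathlib

open scoped TensorProduct

noncomputable section

namespace GradedTor

/-- `K[x_1, …, x_n]`. -/
abbrev PolyX (K : Type*) [Field K] (n : ℕ) : Type _ := MvPolynomial (Fin n) K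

/-- `K[x_1, …, x_n, y_1, …, y_m]`. -/
abbrev PolyXY (K : Type*) [Field K] (n m : ℕ) : Type _ := MvPolynomial (Fin n ⊕ Fin m) K

/-- `K[x]` is viewed as a subring of `K[x, y]` in the obvious way. -/
instance algebraXY (K : Type*) [Field K] (n m : ℕ) : Algebra (PolyX K n) (PolyXY K n m) :=
  (MvPolynomial.rename (R := K) (Sum.inl : Fin n → Fin n ⊕ Fin m)).toRingHom.toAlgebra

instance isScalarTowerXY (K : Type*) [Field K] (n m : ℕ) :
    IsScalarTower K (PolyX K n) (PolyXY K n m) :=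
  IsScalarTower.of_algebraMap_eq fun c =>
    ((MvPolynomial.rename (R := K) (Sum.inl : Fin n → Fin n ⊕ Fin m)).commutes c).symm

/-- The standard grading of `K[x]`: the degree of every `x_i` is `1`. -/
def gradingX (K : Type*) [Field K] (n : ℕ) : ℤ → Submodule K (PolyX K n) :=
  MvPolynomial.weightedHomogeneousSubmodule K (fun _ : Fin n => (1 : ℤ))

/-- The bigrading of `K[x, y]`: `deg x_i = (1, 0)` and `deg y_j = (p_j, 1)`. -/
def gradingXY (K : Type*) [Field K] (n : ℕ) {m : ℕ} (p : Fin m → ℕ) :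
    ℤ × ℤ → Submodule K (PolyXY K n m) :=
  MvPolynomial.weightedHomogeneousSubmodule K
    (Sum.elim (fun _ : Fin n => ((1 : ℤ), (0 : ℤ))) (fun j : Fin m => ((p j : ℤ), (1 : ℤ))))

/-- The bigrading of the free module `⨁_b A(-δ b)` over `A = K[x, y]`, whose basis element with
index `b` has bidegree `δ b`: an element has bidegree `g` if and only if its coefficient at `b` is
bihomogeneous of bidegree `g - δ b`, for every `b`. -/
def freeGrading {K : Type*} [Field K] {n m : ℕ} (p : Fin m → ℕ) {ι : Type*} (δ : ι → ℤ × ℤ)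
    (g : ℤ × ℤ) : Submodule K (ι →₀ PolyXY K n m) where
  carrier := {f | ∀ b, f b ∈ gradingXY K n p (g - δ b)}
  add_mem' hf hf' b := add_mem (hf b) (hf' b)
  zero_mem' _ := zero_mem _
  smul_mem' c _ hf b := Submodule.smul_mem _ c (hf b)

/-- The component `X_k = ⨁_c X_(c,k)` of a bigraded module, as a module over `K[x]`. Multiplication
by the `x_i` does not change the second degree, so that this span is the sum of the `X_(c,k)`. -/
def component {K : Type*} [Field K] (n : ℕ) {X : Type*} [AddCommGroup X] [Module K X]
    [Module (PolyX K n) X] (𝒳 : ℤ × ℤ → Submodule K X) (k : ℤ) : Submodule (PolyX K n) X :=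
  Submodule.span (PolyX K n) (⋃ c : ℤ, (𝒳 (c, k) : Set X))

/-- A bigraded free resolution `⋯ → F_1 → F_0 → N → 0` of the bigraded `K[x, y]`-module `N`, where
`F_i` is the free module `⨁_{b : ι i} A(-deg i b)` over `A = K[x, y]`. -/
structure BigradedFreeResolution {K : Type*} [Field K] (n : ℕ) {m : ℕ} (p : Fin m → ℕ)
    {N : Type*} [AddCommGroup N] [Module K N] [Module (PolyXY K n m) N]
    (𝒩 : ℤ × ℤ → Submodule K N) where
  /-- The index set of the basis of `F_i`. -/
  ι : ℕ → Type*
  /-- The bidegrees of the basis elements of `F_i`. -/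
  deg : ∀ i, ι i → ℤ × ℤ
  /-- The differential `F_{i+1} → F_i`. -/
  d : ∀ i, (ι (i + 1) →₀ PolyXY K n m) →ₗ[PolyXY K n m] (ι i →₀ PolyXY K n m)
  /-- The augmentation `F_0 → N`. -/
  aug : (ι 0 →₀ PolyXY K n m) →ₗ[PolyXY K n m] N
  d_mem : ∀ i g f, f ∈ freeGrading p (deg (i + 1)) g → d i f ∈ freeGrading p (deg i) g
  aug_mem : ∀ g f, f ∈ freeGrading p (deg 0) g → aug f ∈ 𝒩 g
  exact_d : ∀ i, Function.Exact (d (i + 1)) (d i)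
  exact_aug : Function.Exact (d 0) aug
  aug_surjective : Function.Surjective aug

namespace BigradedFreeResolution

variable {K : Type*} [Field K] {n m : ℕ} {p : Fin m → ℕ}
  {N : Type*} [AddCommGroup N] [Module K N] [Module (PolyXY K n m) N]
  {𝒩 : ℤ × ℤ → Submodule K N} (F : BigradedFreeResolution n p 𝒩)
  (M : Type*) [AddCommGroup M] [Module (PolyX K n) M]

/-- The module `M ⊗_S F_i` in the complex `M ⊗_S F`, where `S = K[x]`. -/
abbrev tensor (i : ℕ) : Type _ := M ⊗[PolyX K n] (F.ι i →₀ PolyXY K n m)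

/-- The differential `M ⊗_S F_{i+1} → M ⊗_S F_i`. -/
def tensorD (i : ℕ) : F.tensor M (i + 1) →ₗ[PolyX K n] F.tensor M i :=
  ((F.d i).restrictScalars (PolyX K n)).lTensor M

/-- The cycles of `M ⊗_S F` in homological degree `i`. -/
def cycles : (i : ℕ) → Submodule (PolyX K n) (F.tensor M i)
  | 0 => ⊤
  | i + 1 => LinearMap.ker (F.tensorD M i)

/-- The boundaries of `M ⊗_S F` in homological degree `i`. -/
def boundaries (i : ℕ) : Submodule (PolyX K n) (F.tensor M i) :=
  LinearMap.range (F.tensorD M i)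

/-- `Tor_i^S(M, N) = H_i(M ⊗_S F)`, for `S = K[x]`. The bigraded free `K[x, y]`-modules `F_i` are
free over `S`, so that `F` is also a free resolution of `N` over `S`. -/
abbrev Tor (i : ℕ) : Type _ := F.cycles M i ⧸ (F.boundaries M i).submoduleOf (F.cycles M i)

variable {M} [Module K M] [IsScalarTower K (PolyX K n) M] (ℳ : ℤ → Submodule K M)

/-- The bigrading of `M ⊗_S F_i`: the component of bidegree `(c, k)` is spanned by the `u ⊗ v` with
`u` homogeneous of degree `a`, `v` bihomogeneous of bidegree `(b, k)` and `a + b = c`. -/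
def tensorGrading (i : ℕ) (g : ℤ × ℤ) : Submodule K (F.tensor M i) :=
  Submodule.span K {z | ∃ a b : ℤ, a + b = g.1 ∧ ∃ u ∈ ℳ a,
    ∃ v ∈ freeGrading p (F.deg i) (b, g.2), z = u ⊗ₜ[PolyX K n] v}

/-- The bigrading of `Tor_i^S(M, N)`: the component of bidegree `g` consists of the classes of the
cycles of bidegree `g`. -/
def torGrading (i : ℕ) (g : ℤ × ℤ) : Submodule K (F.Tor M i) :=
  ((F.tensorGrading ℳ i g).comap ((F.cycles M i).subtype.restrictScalars K)).map
    (((F.boundaries M i).submoduleOf (F.cycles M i)).mkQ.restrictScalars K)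

/-- The graded `S`-module `Tor_i^S(M, N)_k`; its component of degree `c` is
`F.torGrading ℳ i (c, k)`. -/
def torComponent (i : ℕ) (k : ℤ) : Submodule (PolyX K n) (F.Tor M i) :=
  component n (F.torGrading ℳ i) k

end BigradedFreeResolution

/-- The higher iterated Hilbert functions of a graded module with components `𝒳 t`:
`H_0(t) = dim_K 𝒳 t` and `H_{j+1}(t) = ∑_{s ≤ t} H_j(s)`. -/
def iteratedHilbert {K : Type*} [Field K] {X : Type*} [AddCommGroup X] [Module K X]
    (𝒳 : ℤ → Submodule K X) : ℕ → ℤ → ℕ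
  | 0, t => Module.finrank K (𝒳 t)
  | j + 1, t => ∑ᶠ s ∈ Set.Iic t, iteratedHilbert 𝒳 j s

/-- `P` is the `j`-th iterated Hilbert polynomial of the graded module with components `𝒳 t`. -/
def IsIteratedHilbertPolynomial {K : Type*} [Field K] {X : Type*} [AddCommGroup X] [Module K X]
    (𝒳 : ℤ → Submodule K X) (j : ℕ) (P : Polynomial ℚ) : Prop :=
  ∀ᶠ t : ℤ in Filter.atTop, (iteratedHilbert 𝒳 j t : ℚ) = P.eval (t : ℚ)

section Existence

variable {K : Type*} [Field K] {n m : ℕ} (p : Fin m → ℕ)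

/-- Every element is a finite sum of homogeneous ones, and in only one way. -/
structure IsGrading {X : Type*} [AddCommGroup X] [Module K X] (𝒳 : ℤ × ℤ → Submodule K X) :
    Prop where
  exists_sum : ∀ x, ∃ f : ℤ × ℤ →₀ X, (∀ g, f g ∈ 𝒳 g) ∧ (f.sum fun _ y => y) = x
  eq_zero : ∀ f : ℤ × ℤ →₀ X, (∀ g, f g ∈ 𝒳 g) → (f.sum fun _ y => y) = 0 → f = 0

theorem isGrading_of_decomposition {X : Type*} [AddCommGroup X] [Module K X]
    (𝒳 : ℤ × ℤ → Submodule K X) [DirectSum.Decomposition 𝒳] : IsGrading 𝒳 where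
  exists_sum x := by
    classical
    refine ⟨(DirectSum.decompose 𝒳 x).support.sum
      fun g => Finsupp.single g (DirectSum.decompose 𝒳 x g : X), fun g => ?_, ?_⟩
    · rw [Finsupp.finsetSum_apply]
      refine sum_mem fun i _ => ?_
      rw [Finsupp.single_apply]
      split_ifs with h
      · exact h ▸ SetLike.coe_mem _
      · exact zero_mem _
    · rw [← Finsupp.sum_finsetSum_index (by simp) (by simp)]
      simpa using DirectSum.sum_support_decompose 𝒳 x
  eq_zero f hf h := by
    classical
    ext g
    have := congrArg (fun x => (DirectSum.decompose 𝒳 x g : X)) h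
    simp only [Finsupp.sum, DirectSum.decompose_sum, DirectSum.decompose_zero] at this
    rw [DFinsupp.finsetSum_apply, AddSubmonoidClass.coe_finsetSum] at this
    simp only [DirectSum.zero_apply, ZeroMemClass.coe_zero] at this
    rw [Finset.sum_eq_single g] at this
    · rwa [DirectSum.decompose_of_mem_same 𝒳 (hf g)] at this
    · intro b _ hb
      exact DirectSum.decompose_of_mem_ne 𝒳 (hf b) hb
    · intro hg
      simp [Finsupp.notMem_support_iff.mp hg]

theorem isGrading_gradingXY : IsGrading (gradingXY K n p) := by
  let _ : DirectSum.Decomposition (gradingXY K n p) := MvPolynomial.weightedDecomposition K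
    (Sum.elim (fun _ : Fin n => ((1 : ℤ), (0 : ℤ))) (fun j : Fin m => ((p j : ℤ), (1 : ℤ))))
  exact isGrading_of_decomposition _

theorem isGrading_freeGrading {ι : Type*} [Finite ι] (δ : ι → ℤ × ℤ) :
    IsGrading (freeGrading (K := K) (n := n) p δ) where
  exists_sum x := by
    classical
    have := Fintype.ofFinite ι
    choose f hf hs using fun b => (isGrading_gradingXY (K := K) (n := n) p).exists_sum (x b)
    refine ⟨∑ b, (f b).sum fun g a => Finsupp.single (g + δ b) (Finsupp.single b a), ?_, ?_⟩
    · intro g b'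
      rw [Finsupp.finsetSum_apply, Finsupp.finsetSum_apply]
      refine sum_mem fun b _ => ?_
      rw [Finsupp.sum, Finsupp.finsetSum_apply, Finsupp.finsetSum_apply]
      refine sum_mem fun h _ => ?_
      rw [Finsupp.single_apply]
      split_ifs with e
      · rw [Finsupp.single_apply]
        split_ifs with e'
        · subst e e'
          simpa using hf b h
        · exact zero_mem _
      · exact zero_mem _
    · rw [← Finsupp.sum_finsetSum_index (by simp) (by simp)]
      have : ∀ b, (((f b).sum fun g a => Finsupp.single (g + δ b) (Finsupp.single b a)).sum
          fun _ y => y) = Finsupp.single b (x b) := by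
        intro b
        rw [Finsupp.sum_sum_index (by simp) (by simp), ← hs b]
        have h2 : ∀ g a, (Finsupp.single (g + δ b) (Finsupp.single b a)).sum
            (fun _ (y : ι →₀ PolyXY K n m) => y) = Finsupp.single b a :=
          fun g a => Finsupp.sum_single_index rfl
        refine (Finset.sum_congr rfl fun g _ => h2 g _).trans ?_
        exact (map_sum (Finsupp.singleAddHom (M := PolyXY K n m) b) _ _).symm
      rw [Finset.sum_congr rfl fun b _ => this b]
      exact Finsupp.univ_sum_single x
  eq_zero f hf h := by
    classical
    ext1 g
    ext1 b
    have key : ∀ b, (f.sum fun g y => Finsupp.single (g - δ b) (y b)) = 0 := by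
      intro b
      refine (isGrading_gradingXY (K := K) (n := n) p).eq_zero _ ?_ ?_
      · intro g
        rw [Finsupp.sum, Finsupp.finsetSum_apply]
        refine sum_mem fun i _ => ?_
        rw [Finsupp.single_apply]
        split_ifs with e
        · exact e ▸ hf i b
        · exact zero_mem _
      · rw [Finsupp.sum_sum_index (by simp) (by simp)]
        have := DFunLike.congr_fun h b
        have h2 : ∀ (g : ℤ × ℤ) (y : ι →₀ PolyXY K n m), (Finsupp.single (g - δ b) (y b)).sum
            (fun _ y => y) = y b := fun g y => Finsupp.sum_single_index rfl
        simp only [h2]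
        simpa [Finsupp.sum, Finsupp.finsetSum_apply] using this
    have := DFunLike.congr_fun (key b) (g - δ b)
    rw [Finsupp.sum, Finsupp.finsetSum_apply, Finset.sum_eq_single g] at this
    · simpa using this
    · intro i _ hi
      rw [Finsupp.single_eq_of_ne]
      exact fun e => hi (by simpa using e.symm)
    · intro hg
      simp [Finsupp.notMem_support_iff.mp hg]

/-- A finitely generated homogeneous submodule is the image of a bigraded free module. -/
theorem exists_cover {X : Type*} [AddCommGroup X] [Module K X] [Module (PolyXY K n m) X]
    (𝒳 : ℤ × ℤ → Submodule K X)
    (hsm : ∀ g h (a : PolyXY K n m) x, a ∈ gradingXY K n p g → x ∈ 𝒳 h → a • x ∈ 𝒳 (g + h))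
    (Z : Submodule (PolyXY K n m) X) (hfg : Z.FG)
    (hZ : ∀ x ∈ Z, ∃ f : ℤ × ℤ →₀ X, (∀ g, f g ∈ 𝒳 g ∧ f g ∈ Z) ∧ (f.sum fun _ y => y) = x) :
    ∃ (r : ℕ) (δ : Fin r → ℤ × ℤ) (φ : (Fin r →₀ PolyXY K n m) →ₗ[PolyXY K n m] X),
      LinearMap.range φ = Z ∧ ∀ g f, f ∈ freeGrading p δ g → φ f ∈ 𝒳 g := by
  classical
  obtain ⟨s, hs⟩ := hfg
  have hsZ : ∀ x : s, (x : X) ∈ Z := fun x => hs ▸ Submodule.subset_span x.2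
  choose f hf hsum using fun x : s => hZ x (hsZ x)
  let T : Finset ((ℤ × ℤ) × X) := Finset.univ.biUnion fun x => (f x).support.image fun g => (g, f x g)
  have hT : ∀ t ∈ T, t.2 ∈ 𝒳 t.1 ∧ t.2 ∈ Z := by
    intro t ht
    simp only [T, Finset.mem_biUnion, Finset.mem_image] at ht
    obtain ⟨x, _, g, _, rfl⟩ := ht
    exact hf x g
  let e := T.equivFin.symm
  refine ⟨T.card, fun b => (e b).1.1, Finsupp.linearCombination _ fun b => (e b).1.2, ?_, ?_⟩
  · rw [Finsupp.range_linearCombination]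
    refine le_antisymm (Submodule.span_le.2 ?_) ?_
    · rintro _ ⟨b, rfl⟩
      exact (hT _ (e b).2).2
    · conv_lhs => rw [← hs]
      refine Submodule.span_le.2 fun x hx => ?_
      refine (hsum ⟨x, hx⟩).subst (motive := fun y => y ∈ Submodule.span _ _) ?_
      refine sum_mem fun g hg => Submodule.subset_span ?_
      have : (g, f ⟨x, hx⟩ g) ∈ T :=
        Finset.mem_biUnion.2 ⟨⟨x, hx⟩, Finset.mem_univ _, Finset.mem_image.2 ⟨g, hg, rfl⟩⟩
      exact ⟨e.symm ⟨_, this⟩, by simp⟩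
  · intro g v hv
    rw [Finsupp.linearCombination_apply]
    refine sum_mem fun b _ => ?_
    simpa using hsm _ _ _ _ (hv b) (hT _ (e b).2).1

/-- The kernel of a map of bidegree `0` is homogeneous. -/
theorem ker_homogeneous {X Y : Type*} [AddCommGroup X] [Module K X] [Module (PolyXY K n m) X]
    [AddCommGroup Y] [Module K Y] [Module (PolyXY K n m) Y]
    {𝒳 : ℤ × ℤ → Submodule K X} {𝒴 : ℤ × ℤ → Submodule K Y} (hX : IsGrading 𝒳)
    (hY : IsGrading 𝒴) (φ : X →ₗ[PolyXY K n m] Y) (hφ : ∀ g x, x ∈ 𝒳 g → φ x ∈ 𝒴 g) :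
    ∀ x ∈ LinearMap.ker φ, ∃ f : ℤ × ℤ →₀ X,
      (∀ g, f g ∈ 𝒳 g ∧ f g ∈ LinearMap.ker φ) ∧ (f.sum fun _ y => y) = x := by
  intro x hx
  obtain ⟨f, hf, rfl⟩ := hX.exists_sum x
  have := hY.eq_zero (f.mapRange φ (map_zero φ)) (fun g => by simpa using hφ g _ (hf g)) (by
    rw [Finsupp.sum_mapRange_index (by simp)]
    simpa [Finsupp.sum] using hx)
  exact ⟨f, fun g => ⟨hf g, by simpa using DFunLike.congr_fun this g⟩, rfl⟩

theorem smul_mem_freeGrading {ι : Type*} (δ : ι → ℤ × ℤ) (g h : ℤ × ℤ) (a : PolyXY K n m)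
    (x : ι →₀ PolyXY K n m) (ha : a ∈ gradingXY K n p g) (hx : x ∈ freeGrading p δ h) :
    a • x ∈ freeGrading p δ (g + h) := by
  intro b
  have := MvPolynomial.IsWeightedHomogeneous.mul ha (hx b)
  rw [← add_sub_assoc] at this
  exact this

/-- A homogeneous submodule of a bigraded free module of finite rank. -/
structure Stage (K : Type*) [Field K] (n : ℕ) {m : ℕ} (p : Fin m → ℕ) where
  /-- The rank. -/
  r : ℕ
  /-- The bidegrees of the basis. -/
  δ : Fin r → ℤ × ℤ
  /-- The submodule. -/
  Z : Submodule (PolyXY K n m) (Fin r →₀ PolyXY K n m)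
  homogeneous : ∀ x ∈ Z, ∃ f : ℤ × ℤ →₀ (Fin r →₀ PolyXY K n m),
      (∀ g, f g ∈ freeGrading p δ g ∧ f g ∈ Z) ∧ (f.sum fun _ y => y) = x

theorem Stage.exists_next (s : Stage K n p) :
    ∃ (t : Stage K n p) (φ : (Fin t.r →₀ PolyXY K n m) →ₗ[PolyXY K n m]
      (Fin s.r →₀ PolyXY K n m)), LinearMap.range φ = s.Z ∧ LinearMap.ker φ = t.Z ∧
      ∀ g f, f ∈ freeGrading p t.δ g → φ f ∈ freeGrading p s.δ g := by
  obtain ⟨r, δ, φ, h1, h2⟩ := exists_cover p (freeGrading p s.δ) (smul_mem_freeGrading p s.δ) s.Z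
    (IsNoetherian.noetherian _) s.homogeneous
  exact ⟨⟨r, δ, LinearMap.ker φ, ker_homogeneous (isGrading_freeGrading p δ)
    (isGrading_freeGrading p s.δ) φ h2⟩, φ, h1, rfl, h2⟩

/-- Finitely generated bigraded modules have bigraded free resolutions. -/
theorem nonempty_bigradedFreeResolution
    {N : Type*} [AddCommGroup N] [Module K N] [Module (PolyXY K n m) N]
    [Module.Finite (PolyXY K n m) N] (𝒩 : ℤ × ℤ → Submodule K N) [DirectSum.Decomposition 𝒩]
    [SetLike.GradedSMul (gradingXY K n p) 𝒩] :
    Nonempty (BigradedFreeResolution.{_, _, 0} n p 𝒩) := by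
  have hN := isGrading_of_decomposition 𝒩
  obtain ⟨r, δ, ε, h1, h2⟩ := exists_cover (n := n) p 𝒩
    (fun g h a x ha hx => SetLike.GradedSMul.smul_mem ha hx) ⊤
    Module.Finite.fg_top
    (fun x _ => by
      obtain ⟨f, hf, h⟩ := hN.exists_sum x
      exact ⟨f, fun g => ⟨hf g, trivial⟩, h⟩)
  choose next φ hr hk hφ using Stage.exists_next (K := K) (n := n) (p := p)
  let s0 : Stage K n p := ⟨r, δ, LinearMap.ker ε,
    ker_homogeneous (isGrading_freeGrading p δ) hN ε h2⟩
  let st : ℕ → Stage K n p := fun i => Nat.rec s0 (fun _ s => next s) i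
  exact ⟨{
    ι := fun i => Fin (st i).r
    deg := fun i => (st i).δ
    d := fun i => φ (st i)
    aug := ε
    d_mem := fun i => hφ (st i)
    aug_mem := h2
    exact_d := fun i => LinearMap.exact_iff.2 ((hk (st i)).trans (hr (st (i + 1))).symm)
    exact_aug := LinearMap.exact_iff.2 (hr s0).symm
    aug_surjective := LinearMap.range_eq_top.1 h1 }⟩

end Existence

end GradedTor

end

open scoped Pointwise

noncomputable section

namespace GradedTor

/-! ### Rigidity of chain complexes, and its passage from `C` to `C / f C` -/

section Complexes

variable {R : Type*} [CommRing R]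

/-! The heart is Auslander's rigidity of Tor over `S = K[x]` in pointwise form: if Tor_i vanishes at
a prime, so does Tor_{i+1}. Then supports shrink as `i` grows, and dimensions with them.

Rigidity is proved by reduction to the diagonal. Let `T` be a second copy of `S`, acting on `M`, and
let `S` act on `M[t] = T[t] ⊗_T M` through the variables `t`. Then `M[t]` is `S ⊗_K M`, which is
flat over `S`. So for a resolution `P` of a finitely generated module `L`, the complex `M[t] ⊗_S P`
is exact in positive degrees and rigid for a trivial reason (`tensorComplex_of_flat`). The `t_i -
x_i` form a weakly regular sequence on `M[t]` with quotient `M`, and they remain regular after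
tensoring with the flat `P_i`. It remains to pass from `C` to `C / f C` for a regular `f`
(`IsRigid.quotient`). If `f` lies in the prime and H_i(C / f C) vanishes there, then H_i(C) = f
H_i(C) locally, so H_i(C) vanishes by Nakayama; rigidity of `C` removes H_{i+1}(C), and the long
exact sequence removes H_{i+1}(C / f C). Nakayama needs finitely generated homology, which is
therefore carried along, over the ring `T[t]`.

For the bigraded statement, `S` sits in second degree 0, so taking the part of second degree `k` is
an `S`-linear projection. Hence the `(F_i)_k` form a flat resolution of `N_k`, and Tor_i(M, N)_k is
the homology of `M ⊗ F_k` (`exists_equiv_torComponent`). Since `N_k` is finitely generated over `S`,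
rigidity applies, and H_0 = M ⊗ N_k gives the second bound.

For large `k` the `y_j` map `N_k` onto generators of `N_{k+1}`, so the annihilators of `M ⊗ N_k`
ascend and become stationary; so does the dimension. Finally, a graded module of dimension at most
`D` has a Hilbert polynomial of degree less than `D`, by induction on `D` and on the variables that
are not nilpotent, and each summation raises the bound by one. -/

theorem mem_submoduleOf_iff {X : Type*} [AddCommGroup X] [Module R X] {B Z : Submodule R X}
    {z : Z} : z ∈ B.submoduleOf Z ↔ (z : X) ∈ B :=
  Iff.rfl

/-- Nakayama at `p` by Cayley–Hamilton: `s` maps `H` into `f H`, so it is a root on `H` of a monic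
`P` whose lower coefficients lie in powers of `(f) ⊆ p`. Thus `P(s)` kills `H`, and modulo `p` it is
a power of `s`. -/
theorem exists_smul_eq_zero_of_smul_mem_smul {H : Type*} [AddCommGroup H] [Module R H]
    [Module.Finite R H] {p : Ideal R} (hp : p.IsPrime) {s f : R} (hs : s ∉ p) (hf : f ∈ p)
    (h : ∀ x : H, ∃ y : H, s • x = f • y) : ∃ t, t ∉ p ∧ ∀ x : H, t • x = 0 := by
  obtain ⟨P, hP, -, hc, h0⟩ :=
    LinearMap.exists_monic_and_natDegree_eq_and_coeff_mem_pow_and_aeval_eq_zero R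
      (algebraMap R (Module.End R H) s) (Ideal.span {f}) (by
        rintro _ ⟨x, rfl⟩
        obtain ⟨y, hy⟩ := h x
        rw [Module.algebraMap_end_apply, hy]
        exact Submodule.smul_mem_smul (Ideal.mem_span_singleton_self f) trivial)
  refine ⟨P.eval s, fun ht => hs ?_, fun x => ?_⟩
  · have hle : Ideal.span {f} ≤ p := by simpa [Ideal.span_le] using hf
    rw [Polynomial.eval_eq_sum_range, Finset.sum_range_succ, hP.coeff_natDegree, one_mul] at ht
    refine hp.mem_of_pow_mem _ ((Submodule.add_mem_iff_right p ?_).1 ht)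
    refine sum_mem fun k hk => Ideal.mul_mem_right _ _ (hle ?_)
    exact Ideal.pow_le_self (Nat.sub_ne_zero_of_lt (Finset.mem_range.1 hk)) (hc k)
  · rw [Polynomial.aeval_algebraMap_apply_eq_algebraMap_eval] at h0
    simpa using LinearMap.congr_fun h0 x

variable {C : ℕ → Type*} [∀ i, AddCommGroup (C i)] [∀ i, Module R (C i)]
  {D : ℕ → Type*} [∀ i, AddCommGroup (D i)] [∀ i, Module R (D i)]

/-- The cycles of a chain complex that ends in degree `0`. -/
def chainCycles (d : ∀ i, C (i + 1) →ₗ[R] C i) : (i : ℕ) → Submodule R (C i)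
  | 0 => ⊤
  | i + 1 => LinearMap.ker (d i)

/-- The homology of a chain complex that ends in degree `0`. -/
abbrev chainHomology (d : ∀ i, C (i + 1) →ₗ[R] C i) (i : ℕ) : Type _ :=
  chainCycles d i ⧸ (LinearMap.range (d i)).submoduleOf (chainCycles d i)

/-- All homology modules are finitely generated. -/
def HasFiniteHomology (d : ∀ i, C (i + 1) →ₗ[R] C i) : Prop :=
  ∀ i, ∃ G : Submodule R (C i), G.FG ∧ G ≤ chainCycles d i ∧
    chainCycles d i ≤ G ⊔ LinearMap.range (d i)

/-- Wherever the homology in some degree vanishes, so does the one in the next degree. -/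
def IsRigid (d : ∀ i, C (i + 1) →ₗ[R] C i) : Prop :=
  ∀ (p : Ideal R), p.IsPrime → ∀ i, (∃ s, s ∉ p ∧ ∀ z ∈ chainCycles d i, s • z ∈ (d i).range) →
    ∃ s, s ∉ p ∧ ∀ z ∈ chainCycles d (i + 1), s • z ∈ (d (i + 1)).range

theorem HasFiniteHomology.finite {d : ∀ i, C (i + 1) →ₗ[R] C i} (h : HasFiniteHomology d) (i : ℕ) :
    Module.Finite R (chainHomology d i) := by
  obtain ⟨G, hG, hGZ, hZ⟩ := h i
  refine ⟨?_⟩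
  have h1 : (G.submoduleOf (chainCycles d i)).FG := by
    refine Submodule.fg_of_fg_map_injective (chainCycles d i).subtype
      (Submodule.subtype_injective _) ?_
    rwa [Submodule.submoduleOf, Submodule.map_comap_subtype, inf_eq_right.2 hGZ]
  convert! h1.map ((LinearMap.range (d i)).submoduleOf (chainCycles d i)).mkQ
  refine (eq_top_iff.2 ?_).symm
  rintro x -
  obtain ⟨⟨z, hz⟩, rfl⟩ := Submodule.mkQ_surjective _ x
  obtain ⟨g, hg, b, hb, rfl⟩ := Submodule.mem_sup.1 (hZ hz)
  refine ⟨⟨g, hGZ hg⟩, hg, ?_⟩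
  refine (Submodule.Quotient.eq _).2 ?_
  rw [mem_submoduleOf_iff]
  simpa using hb

/-- For finitely generated homology, a prime is outside the support exactly if a single element
outside the prime kills the homology, which is the condition in `IsRigid`. -/
theorem IsRigid.support_subset {d : ∀ i, C (i + 1) →ₗ[R] C i} (h : IsRigid d)
    (hf : HasFiniteHomology d) (i : ℕ) :
    Module.support R (chainHomology d (i + 1)) ⊆ Module.support R (chainHomology d i) := by
  have key : ∀ i (p : PrimeSpectrum R), p ∉ Module.support R (chainHomology d i) ↔
      ∃ s, s ∉ p.asIdeal ∧ ∀ z ∈ chainCycles d i, s • z ∈ (d i).range := by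
    intro i p
    have := hf.finite i
    rw [Module.mem_support_iff_of_finite, SetLike.not_le_iff_exists]
    refine exists_congr fun s => ?_
    rw [and_comm, Module.mem_annihilator, (Submodule.mkQ_surjective _).forall, Subtype.forall]
    refine and_congr_right fun _ => forall₂_congr fun z hz => ?_
    rw [← map_smul, Submodule.mkQ_apply, Submodule.Quotient.mk_eq_zero, mem_submoduleOf_iff]
    rfl
  intro p hp
  by_contra hn
  exact (key _ _).2 (h _ p.2 i ((key _ _).1 hn)) hp

theorem exists_fg_le_map_eq {X Y : Type*} [AddCommGroup X] [Module R X] [AddCommGroup Y]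
    [Module R Y] (φ : X →ₗ[R] Y) (Z : Submodule R X) {W : Submodule R Y} (hW : W.FG)
    (h : W ≤ Z.map φ) : ∃ T ≤ Z, T.FG ∧ T.map φ = W := by
  obtain ⟨s, rfl⟩ := hW
  have hs : ∀ y ∈ s, ∃ x ∈ Z, φ x = y := fun y hy => h (Submodule.subset_span hy)
  choose! g hg hφ using hs
  refine ⟨Submodule.span R (g '' s), ?_, Submodule.fg_span (s.finite_toSet.image g), ?_⟩
  · rw [Submodule.span_le]
    rintro _ ⟨y, hy, rfl⟩
    exact hg y hy
  · rw [Submodule.map_span, Set.image_image]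
    congr 1
    ext y
    constructor
    · rintro ⟨y, hy, rfl⟩
      simpa [hφ y hy] using hy
    · exact fun hy => ⟨y, hy, hφ y hy⟩

section Quotient

variable {dC : ∀ i, C (i + 1) →ₗ[R] C i} {dD : ∀ i, D (i + 1) →ₗ[R] D i} {f : R}
  (q : ∀ i, C i →ₗ[R] D i)

theorem mem_chainCycles_of_map (hq : ∀ i x, q i (dC i x) = dD i (q (i + 1) x)) (i : ℕ) (z : C i)
    (hz : z ∈ chainCycles dC i) : q i z ∈ chainCycles dD i := by
  cases i with
  | zero => trivial
  | succ i =>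
    have hz : dC i z = 0 := hz
    change dD i _ = 0
    rw [← hq, hz, map_zero]

theorem smul_mem_chainCycles_iff (hf : ∀ i, IsSMulRegular (C i) f) (i : ℕ) (z : C i) :
    f • z ∈ chainCycles dC i ↔ z ∈ chainCycles dC i := by
  cases i with
  | zero => exact iff_of_true trivial trivial
  | succ i =>
    change dC i _ = 0 ↔ dC i _ = 0
    rw [map_smul]
    exact ⟨fun h => hf i (h.trans (smul_zero f).symm), fun h => by rw [h, smul_zero]⟩

theorem range_le_chainCycles (hd : ∀ i x, dC i (dC (i + 1) x) = 0) (i : ℕ) (x : C (i + 1)) :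
    dC i x ∈ chainCycles dC i := by
  cases i with
  | zero => trivial
  | succ i => exact hd i x

/-- If `f` is regular on the complex `C`, then the homology of `C / f C` is finitely generated if
the one of `C` is. -/
theorem HasFiniteHomology.quotient [IsNoetherianRing R] (hC : HasFiniteHomology dC)
    (hd : ∀ i x, dC i (dC (i + 1) x) = 0)
    (hf : ∀ i, IsSMulRegular (C i) f) (hq : ∀ i x, q i (dC i x) = dD i (q (i + 1) x))
    (hs : ∀ i, Function.Surjective (q i)) (hk : ∀ i x, q i x = 0 ↔ ∃ y, x = f • y) :
    HasFiniteHomology dD := by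
  intro i
  cases i with
  | zero =>
    obtain ⟨G, hG, -, hZ⟩ := hC 0
    refine ⟨G.map (q 0), hG.map _, le_top, ?_⟩
    rintro x -
    obtain ⟨x, rfl⟩ := hs 0 x
    obtain ⟨g, hg, _, ⟨b, rfl⟩, rfl⟩ := Submodule.mem_sup.1 (hZ (show x ∈ ⊤ from trivial))
    rw [map_add, hq]
    exact Submodule.add_mem_sup ⟨g, hg, rfl⟩ ⟨_, rfl⟩
  | succ i =>
    obtain ⟨G, hG, hGZ, hZ⟩ := hC i
    obtain ⟨G', hG', hGZ', hZ'⟩ := hC (i + 1)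
    let Z : Submodule R (C (i + 1)) := (LinearMap.ker (dD i)).comap (q (i + 1))
    have hmemZ : ∀ x, x ∈ Z ↔ ∃ y, dC i x = f • y := by
      intro x
      rw [← hk, hq]
      rfl
    -- `Z` consists of the lifts of cycles of `C / f C`, and `W` of those `g ∈ G` for which `f g`
    -- bounds a chain. `T` lifts generators of `f W` along the differential, so it supplies the
    -- cycles with nonzero image under the connecting map; `G'` supplies those that come from cycles
    -- of `C`.
    let W : Submodule R (C i) := G ⊓ (Z.map (dC i)).comap (LinearMap.lsmul R _ f)
    have hW : W.FG := hG.of_le inf_le_left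
    obtain ⟨T, hTZ, hT, hTW⟩ := exists_fg_le_map_eq (dC i) Z (hW.map (LinearMap.lsmul R _ f))
      (by rintro _ ⟨x, hx, rfl⟩; exact hx.2)
    refine ⟨T.map (q (i + 1)) ⊔ G'.map (q (i + 1)), (hT.map _).sup (hG'.map _), ?_, ?_⟩
    · refine sup_le ?_ ?_
      · rintro _ ⟨x, hx, rfl⟩
        exact hTZ hx
      · rintro _ ⟨x, hx, rfl⟩
        exact mem_chainCycles_of_map q hq _ _ (hGZ' hx)
    · intro x hx
      obtain ⟨z, rfl⟩ := hs _ x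
      obtain ⟨c, hc⟩ := (hmemZ z).1 hx
      have hcZ : c ∈ chainCycles dC i := by
        rw [← smul_mem_chainCycles_iff hf, ← hc]
        exact range_le_chainCycles hd i z
      obtain ⟨g, hg, _, ⟨e, rfl⟩, rfl⟩ := Submodule.mem_sup.1 (hZ hcZ)
      have hgW : g ∈ W := by
        -- Subtracting `f e` does not change the class modulo `f`, and makes the boundary exactly `f
        -- g`.
        refine ⟨hg, z - f • e, ?_, ?_⟩
        · rw [SetLike.mem_coe, hmemZ]
          exact ⟨g, by rw [map_sub, hc, map_smul, smul_add, add_sub_cancel_right]⟩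
        · rw [map_sub, hc, map_smul, smul_add, add_sub_cancel_right, LinearMap.lsmul_apply]
      obtain ⟨t, ht, htg⟩ : f • g ∈ T.map (dC i) := hTW ▸ ⟨g, hgW, rfl⟩
      have : z - f • e - t ∈ chainCycles dC (i + 1) := by
        change dC i _ = 0
        rw [map_sub, htg, map_sub, hc, map_smul, smul_add, add_sub_cancel_right, sub_self]
      obtain ⟨g', hg', _, ⟨b, rfl⟩, hb⟩ := Submodule.mem_sup.1 (hZ' this)
      have hz : z = t + g' + dC (i + 1) b + f • e := by
        rw [add_assoc t, hb]; abel
      rw [hz, map_add, (hk _ _).2 ⟨e, rfl⟩, add_zero, map_add, map_add, hq]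
      exact Submodule.add_mem_sup (Submodule.add_mem_sup ⟨t, ht, rfl⟩ ⟨g', hg', rfl⟩) ⟨_, rfl⟩

/-- If `f` is regular on the complex `C`, then `C / f C` is rigid if `C` is. -/
theorem IsRigid.quotient (hC : IsRigid dC) (hfin : HasFiniteHomology dC)
    (hd : ∀ i x, dC i (dC (i + 1) x) = 0)
    (hf : ∀ i, IsSMulRegular (C i) f) (hq : ∀ i x, q i (dC i x) = dD i (q (i + 1) x))
    (hs : ∀ i, Function.Surjective (q i)) (hk : ∀ i x, q i x = 0 ↔ ∃ y, x = f • y) :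
    IsRigid dD := by
  rintro p hp i ⟨s, hsp, hsz⟩
  by_cases hfp : f ∈ p
  swap
  -- Outside `p`, the element `f` itself annihilates the whole quotient complex.
  · refine ⟨f, hfp, fun z _ => ?_⟩
    obtain ⟨z, rfl⟩ := hs _ z
    rw [← map_smul, (hk _ _).2 ⟨z, rfl⟩]
    exact zero_mem _
  -- This is the inclusion s H_i(C) ⊆ f H_i(C). The chain `c` is a cycle because `f c` is one and
  -- `f` is regular.
  have h1 : ∀ z ∈ chainCycles dC i, ∃ c ∈ chainCycles dC i, s • z - f • c ∈ (dC i).range := by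
    intro z hz
    obtain ⟨w, hw⟩ := hsz _ (mem_chainCycles_of_map q hq i z hz)
    obtain ⟨w, rfl⟩ := hs _ w
    rw [← hq, ← map_smul, eq_comm, ← sub_eq_zero, ← map_sub, hk] at hw
    obtain ⟨c, hc⟩ := hw
    refine ⟨c, ?_, w, by rw [← hc, sub_sub_cancel]⟩
    rw [← smul_mem_chainCycles_iff hf, ← hc]
    exact sub_mem (Submodule.smul_mem _ _ hz) (range_le_chainCycles hd i w)
  have := hfin.finite i
  obtain ⟨t, htp, ht⟩ := exists_smul_eq_zero_of_smul_mem_smul (H := chainHomology dC i) hp hsp hfp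
    (by
      intro x
      obtain ⟨⟨z, hz⟩, rfl⟩ := Submodule.mkQ_surjective _ x
      obtain ⟨c, hc, h⟩ := h1 z hz
      refine ⟨Submodule.mkQ _ ⟨c, hc⟩, ?_⟩
      rw [← map_smul, ← map_smul]
      refine (Submodule.Quotient.eq _).2 ?_
      rw [mem_submoduleOf_iff]
      exact h)
  have ht' : ∀ z ∈ chainCycles dC i, t • z ∈ (dC i).range := by
    intro z hz
    have := ht (Submodule.mkQ _ ⟨z, hz⟩)
    rw [← map_smul, Submodule.mkQ_apply, Submodule.Quotient.mk_eq_zero,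
      mem_submoduleOf_iff] at this
    exact this
  obtain ⟨u, hup, hu⟩ := hC p hp i ⟨t, htp, ht'⟩
  -- Here `t` kills H_i(C) and `u` kills H_{i+1}(C). For a lift `z` with boundary `f c`, write `t c`
  -- as the boundary of `e`; then `t z - f e` is a cycle, and `u` times it is a boundary.
  refine ⟨u * t, fun h => (hp.mem_or_mem h).elim hup htp, fun z hz => ?_⟩
  obtain ⟨z, rfl⟩ := hs _ z
  have hz : dD i (q (i + 1) z) = 0 := hz
  rw [← hq, hk] at hz
  obtain ⟨c, hc⟩ := hz
  have hcZ : c ∈ chainCycles dC i := by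
    rw [← smul_mem_chainCycles_iff hf, ← hc]
    exact range_le_chainCycles hd i z
  obtain ⟨e, he⟩ := ht' c hcZ
  obtain ⟨g, hg⟩ := hu (t • z - f • e) (by
    change dC i _ = 0
    rw [map_sub, map_smul, map_smul, he, hc, smul_comm, sub_self])
  refine ⟨q _ g, ?_⟩
  rw [← hq, hg, map_smul, map_sub, (hk _ _).2 ⟨e, rfl⟩, sub_zero, map_smul, mul_smul]

end Quotient

section Equiv

variable {R' : Type*} [CommRing R'] {D : ℕ → Type*} [∀ i, AddCommGroup (D i)]
  [∀ i, Module R' (D i)] {dC : ∀ i, C (i + 1) →ₗ[R] C i} {dD : ∀ i, D (i + 1) →ₗ[R'] D i}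

theorem map_mem_chainCycles_iff (e : ∀ i, C i ≃+ D i)
    (hd : ∀ i x, e i (dC i x) = dD i (e (i + 1) x)) (i : ℕ) (z : C i) :
    e i z ∈ chainCycles dD i ↔ z ∈ chainCycles dC i := by
  cases i with
  | zero => exact iff_of_true trivial trivial
  | succ i =>
    change dD i _ = 0 ↔ dC i _ = 0
    rw [← hd, EmbeddingLike.map_eq_zero_iff]

theorem map_mem_range_iff (e : ∀ i, C i ≃+ D i)
    (hd : ∀ i x, e i (dC i x) = dD i (e (i + 1) x)) (i : ℕ) (z : C i) :
    e i z ∈ (dD i).range ↔ z ∈ (dC i).range := by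
  constructor
  · rintro ⟨x, hx⟩
    obtain ⟨x, rfl⟩ := (e (i + 1)).surjective x
    rw [← hd] at hx
    exact ⟨x, (e i).injective hx⟩
  · rintro ⟨x, rfl⟩
    exact ⟨_, (hd i x).symm⟩

/-- The ring may change along `φ`: primes pull back, and surjectivity lifts the annihilating
elements. This is what turns rigidity over `T[t]` into rigidity over `S`. -/
theorem IsRigid.of_equiv (h : IsRigid dC) (φ : R →+* R') (hφ : Function.Surjective φ)
    (e : ∀ i, C i ≃+ D i) (he : ∀ i r x, e i (r • x) = φ r • e i x)
    (hd : ∀ i x, e i (dC i x) = dD i (e (i + 1) x)) : IsRigid dD := by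
  have key : ∀ i r, (∀ z ∈ chainCycles dD i, φ r • z ∈ (dD i).range) ↔
      ∀ z ∈ chainCycles dC i, r • z ∈ (dC i).range := by
    intro i r
    rw [(e i).surjective.forall]
    refine forall_congr' fun z => ?_
    rw [map_mem_chainCycles_iff e hd, ← he, map_mem_range_iff e hd]
  rintro p hp i ⟨s, hs, hz⟩
  obtain ⟨s, rfl⟩ := hφ s
  obtain ⟨t, ht, htz⟩ := h (p.comap φ) inferInstance i ⟨s, hs, (key i s).1 hz⟩
  exact ⟨φ t, ht, (key _ t).2 htz⟩

theorem HasFiniteHomology.of_equiv (h : HasFiniteHomology dC) (φ : R →+* R')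
    (e : ∀ i, C i ≃+ D i) (he : ∀ i r x, e i (r • x) = φ r • e i x)
    (hd : ∀ i x, e i (dC i x) = dD i (e (i + 1) x)) : HasFiniteHomology dD := by
  intro i
  obtain ⟨_, ⟨s, rfl⟩, hGZ, hZ⟩ := h i
  refine ⟨Submodule.span R' (e i '' s), Submodule.fg_span (s.finite_toSet.image _), ?_, ?_⟩
  · rw [Submodule.span_le]
    rintro _ ⟨x, hx, rfl⟩
    exact (map_mem_chainCycles_iff e hd i x).2 (hGZ (Submodule.subset_span hx))
  · intro z hz
    obtain ⟨z, rfl⟩ := (e i).surjective z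
    obtain ⟨g, hg, b, hb, rfl⟩ := Submodule.mem_sup.1 (hZ ((map_mem_chainCycles_iff e hd i z).1 hz))
    clear hz
    rw [map_add]
    refine Submodule.add_mem_sup ?_ ((map_mem_range_iff e hd i b).2 hb)
    induction hg using Submodule.span_induction with
    | mem x hx => exact Submodule.subset_span ⟨x, hx, rfl⟩
    | zero => simp
    | add x y _ _ hx hy =>
      rw [map_add]
      exact add_mem hx hy
    | smul a x _ hx =>
      rw [he]
      exact Submodule.smul_mem _ _ hx

end Equiv

end Complexes

/-! ### Tensoring a complex with a module, and cutting down by a regular sequence -/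

section TensorComplex

variable {S : Type*} [CommRing S] (R : Type*) [CommRing R] [Algebra S R]
  (X : Type*) [AddCommGroup X] [Module S X] [Module R X] [IsScalarTower S R X]
  {P : ℕ → Type*} [∀ i, AddCommGroup (P i)] [∀ i, Module S (P i)]

/-- The differential of the complex `X ⊗ P` of `R`-modules, for a complex `P` of `S`-modules. -/
def tensorComplex (dP : ∀ i, P (i + 1) →ₗ[S] P i) (i : ℕ) : X ⊗[S] P (i + 1) →ₗ[R] X ⊗[S] P i :=
  TensorProduct.AlgebraTensorModule.lTensor R X (dP i)

@[simp]
theorem tensorComplex_tmul (dP : ∀ i, P (i + 1) →ₗ[S] P i) (i : ℕ) (x : X) (y : P (i + 1)) :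
    tensorComplex R X dP i (x ⊗ₜ y) = x ⊗ₜ dP i y :=
  rfl

variable {R} in
theorem tensorComplex_comp (dP : ∀ i, P (i + 1) →ₗ[S] P i)
    (hd : ∀ i x, dP i (dP (i + 1) x) = 0) (i : ℕ) (x : X ⊗[S] P (i + 1 + 1)) :
    tensorComplex R X dP i (tensorComplex R X dP (i + 1) x) = 0 := by
  induction x with
  | zero => simp
  | tmul x y => simp [hd]
  | add x y hx hy => rw [map_add, map_add, hx, hy, add_zero]

/-- The complex `X ⊗ P` is rigid and has finitely generated homology. -/
def HasRigidTensor (dP : ∀ i, P (i + 1) →ₗ[S] P i) : Prop :=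
  HasFiniteHomology (C := fun i => X ⊗[S] P i) (tensorComplex R X dP) ∧
    IsRigid (C := fun i => X ⊗[S] P i) (tensorComplex R X dP)

variable {R X}

theorem IsSMulRegular.tensor_flat {Q : Type*} [AddCommGroup Q] [Module S Q] [Module.Flat S Q]
    {f : R} (hf : IsSMulRegular X f) : IsSMulRegular (X ⊗[S] Q) f := by
  have h := Module.Flat.rTensor_preserves_injective_linearMap (M := Q)
    ((LinearMap.lsmul R X f).restrictScalars S) hf
  have e : ∀ z : X ⊗[S] Q, ((LinearMap.lsmul R X f).restrictScalars S).rTensor Q z = f • z := by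
    intro z
    induction z with
    | zero => simp
    | tmul x y => simp [TensorProduct.smul_tmul']
    | add x y hx hy => rw [map_add, hx, hy, smul_add]
  intro x y hxy
  exact h ((e x).trans (hxy.trans (e y).symm))

variable {dP : ∀ i, P (i + 1) →ₗ[S] P i}

section Quotient

variable {Y : Type*} [AddCommGroup Y] [Module S Y] [Module R Y] [IsScalarTower S R Y]

/-- Right exactness of the tensor product: `(X / f X) ⊗ Q` is `(X ⊗ Q) / f (X ⊗ Q)`. -/
theorem rTensor_eq_zero_iff_of_ker {Q : Type*} [AddCommGroup Q] [Module S Q] {f : R}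
    (q : X →ₗ[R] Y) (hq : Function.Surjective q) (hk : ∀ x, q x = 0 ↔ ∃ y, x = f • y)
    (z : X ⊗[S] Q) :
    TensorProduct.AlgebraTensorModule.rTensor S Q q z = 0 ↔ ∃ y, z = f • y := by
  have hex : Function.Exact ((LinearMap.lsmul R X f).restrictScalars S) (q.restrictScalars S) := by
    intro x
    refine (hk x).trans (exists_congr fun y => ?_)
    exact eq_comm
  have e : ∀ z : X ⊗[S] Q, ((LinearMap.lsmul R X f).restrictScalars S).rTensor Q z = f • z := by
    intro z
    induction z with
    | zero => simp
    | tmul x y => simp [TensorProduct.smul_tmul']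
    | add x y hx hy => rw [map_add, hx, hy, smul_add]
  refine (rTensor_exact Q hex hq z).trans (exists_congr fun y => ?_)
  rw [e, eq_comm]

end Quotient

theorem tensorComplex_quotSMulTop [IsNoetherianRing R] [∀ i, Module.Flat S (P i)]
    (hd : ∀ i x, dP i (dP (i + 1) x) = 0) {f : R} (hf : IsSMulRegular X f)
    (h : HasRigidTensor R X dP) :
    HasRigidTensor R (QuotSMulTop f X) dP := by
  let q : X →ₗ[R] QuotSMulTop f X := Submodule.mkQ _
  have hq : Function.Surjective q := Submodule.mkQ_surjective _
  have hk : ∀ x, q x = 0 ↔ ∃ y, x = f • y := by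
    intro x
    refine (Submodule.Quotient.mk_eq_zero _).trans ?_
    rw [Submodule.mem_smul_pointwise_iff_exists]
    simp [eq_comm]
  have hcomm : ∀ i x, TensorProduct.AlgebraTensorModule.rTensor S (P i) q (tensorComplex R X dP i x)
      = tensorComplex R (QuotSMulTop f X) dP i
        (TensorProduct.AlgebraTensorModule.rTensor S (P (i + 1)) q x) := by
    intro i x
    induction x with
    | zero => simp
    | tmul x y => simp
    | add x y hx hy => simp only [map_add, hx, hy]
  have hs : ∀ i, Function.Surjective (TensorProduct.AlgebraTensorModule.rTensor S (P i) q) :=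
    fun i => LinearMap.rTensor_surjective (P i) (g := q.restrictScalars S) hq
  have hker := fun i => rTensor_eq_zero_iff_of_ker (S := S) (Q := P i) q hq hk
  have hreg := fun i => IsSMulRegular.tensor_flat (S := S) (Q := P i) hf
  exact ⟨h.1.quotient (fun i => TensorProduct.AlgebraTensorModule.rTensor S (P i) q)
      (tensorComplex_comp X dP hd) hreg hcomm hs hker,
    h.2.quotient (fun i => TensorProduct.AlgebraTensorModule.rTensor S (P i) q) h.1
      (tensorComplex_comp X dP hd) hreg hcomm hs hker⟩

theorem tensorComplex_of_equiv {R' : Type*} [CommRing R'] [Algebra S R'] {Y : Type*}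
    [AddCommGroup Y] [Module S Y] [Module R' Y] [IsScalarTower S R' Y]
    (φ : R →+* R') (hφ : Function.Surjective φ) (e : X ≃ₗ[S] Y)
    (he : ∀ (r : R) x, e (r • x) = φ r • e x)
    (h : HasRigidTensor R X dP) :
    HasRigidTensor R' Y dP := by
  let e' : ∀ i, X ⊗[S] P i ≃+ Y ⊗[S] P i := fun i => (e.rTensor (P i)).toAddEquiv
  have h1 : ∀ i (r : R) x, e' i (r • x) = φ r • e' i x := by
    intro i r x
    induction x with
    | zero => simp
    | tmul x y => simp [e', TensorProduct.smul_tmul', he]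
    | add x y hx hy => rw [smul_add, map_add, hx, hy, map_add, smul_add]
  have h2 : ∀ i x, e' i (tensorComplex R X dP i x) = tensorComplex R' Y dP i (e' (i + 1) x) := by
    intro i x
    induction x with
    | zero => simp
    | tmul x y => simp [e']
    | add x y hx hy => simp only [map_add, hx, hy]
  exact ⟨h.1.of_equiv φ e' h1 h2, h.2.of_equiv φ hφ e' h1 h2⟩

/-- One regular element is divided out at a time. Weak regularity suffices, since no quotient has to
be nonzero. -/
theorem tensorComplex_quotient_ofList [IsNoetherianRing R] [∀ i, Module.Flat S (P i)]
    (hd : ∀ i x, dP i (dP (i + 1) x) = 0) {rs : List R}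
    (hreg : RingTheory.Sequence.IsWeaklyRegular X rs)
    (h : HasRigidTensor R X dP) :
    HasRigidTensor R (X ⧸ (Ideal.ofList rs • ⊤ : Submodule R X)) dP := by
  induction rs generalizing X with
  | nil =>
    have e : X ≃ₗ[R] X ⧸ (Ideal.ofList ([] : List R) • ⊤ : Submodule R X) :=
      (Submodule.quotEquivOfEqBot _ (by rw [Ideal.ofList_nil, Submodule.bot_smul])).symm
    exact tensorComplex_of_equiv (RingHom.id R) Function.surjective_id (e.restrictScalars S)
      (fun r x => e.map_smul r x) h
  | cons r rs ih =>
    rw [RingTheory.Sequence.isWeaklyRegular_cons_iff] at hreg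
    have := ih (X := QuotSMulTop r X) hreg.2 (tensorComplex_quotSMulTop hd hreg.1 h)
    let e := (Submodule.quotOfListConsSMulTopEquivQuotSMulTopInner X r rs).symm
    exact tensorComplex_of_equiv (RingHom.id R) Function.surjective_id (e.restrictScalars S)
      (fun (a : R) x => e.map_smul a x) this

theorem finite_tensor {L : Type*} [AddCommGroup L] [Module S L] [Module.Finite S L]
    [Module.Finite R X] : Module.Finite R (X ⊗[S] L) := by
  obtain ⟨s, hs⟩ := Module.Finite.fg_top (R := R) (M := X)
  obtain ⟨t, ht⟩ := Module.Finite.fg_top (R := S) (M := L)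
  refine ⟨Submodule.fg_def.2 ⟨(fun z : X × L => z.1 ⊗ₜ[S] z.2) '' ((s : Set X) ×ˢ (t : Set L)),
    (s.finite_toSet.prod t.finite_toSet).image _, eq_top_iff.2 ?_⟩⟩
  rintro z -
  induction z with
  | zero => exact zero_mem _
  | add x y hx hy => exact add_mem hx hy
  | tmul x y =>
    have hx : x ∈ Submodule.span R (s : Set X) := hs ▸ trivial
    have hy : y ∈ Submodule.span S (t : Set L) := ht ▸ trivial
    induction hx using Submodule.span_induction with
    | zero => simp
    | add x x' _ _ hx hx' => rw [TensorProduct.add_tmul]; exact add_mem hx hx'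
    | smul a x _ hx => rw [← TensorProduct.smul_tmul']; exact Submodule.smul_mem _ _ hx
    | mem x hx =>
      induction hy using Submodule.span_induction with
      | zero => simp
      | add x x' _ _ hx hx' => rw [TensorProduct.tmul_add]; exact add_mem hx hx'
      | mem y hy => exact Submodule.subset_span ⟨(x, y), ⟨hx, hy⟩, rfl⟩
      | smul a y _ hy =>
        rw [← TensorProduct.smul_tmul, ← algebraMap_smul R a x, ← TensorProduct.smul_tmul']
        exact Submodule.smul_mem _ _ hy

/-- The start of the reduction: flatness of `X` makes all higher homology vanish, so rigidity is
vacuous, and the homology in degree 0 is `X ⊗ L`, which is finite over `R`. -/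
theorem tensorComplex_of_flat [Module.Flat S X] [Module.Finite R X] {L : Type*} [AddCommGroup L]
    [Module S L] [Module.Finite S L] {ε : P 0 →ₗ[S] L}
    (hd : ∀ i, Function.Exact (dP (i + 1)) (dP i)) (h0 : Function.Exact (dP 0) ε)
    (hε : Function.Surjective ε) :
    HasRigidTensor R X dP := by
  have hex : ∀ i, Function.Exact (tensorComplex R X dP (i + 1)) (tensorComplex R X dP i) :=
    fun i => Module.Flat.lTensor_exact X (hd i)
  have h1 : ∀ i, ∀ z ∈ chainCycles (C := fun i => X ⊗[S] P i) (tensorComplex R X dP) (i + 1),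
      z ∈ (tensorComplex R X dP (i + 1)).range := fun i z hz => (hex i z).1 hz
  refine ⟨fun i => ?_, fun p hp i _ => ⟨1, fun h => hp.ne_top ((Ideal.eq_top_iff_one p).2 h),
    fun z hz => by simpa using h1 i z hz⟩⟩
  cases i with
  | succ i => exact ⟨⊥, Submodule.fg_bot, bot_le, fun z hz => by simpa using h1 i z hz⟩
  | zero =>
    have := finite_tensor (R := R) (X := X) (S := S) (L := L)
    let ψ : X ⊗[S] P 0 →ₗ[R] X ⊗[S] L := TensorProduct.AlgebraTensorModule.lTensor R X ε
    have hψ : Function.Surjective ψ := LinearMap.lTensor_surjective X hε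
    obtain ⟨T, -, hT, hTt⟩ := exists_fg_le_map_eq ψ ⊤ (W := ⊤) Module.Finite.fg_top
      (by rw [Submodule.map_top, LinearMap.range_eq_top.2 hψ])
    refine ⟨T, hT, le_top, fun z _ => ?_⟩
    obtain ⟨t, ht, htz⟩ : ψ z ∈ T.map ψ := hTt ▸ trivial
    have : z - t ∈ (tensorComplex R X dP 0).range :=
      (lTensor_exact X h0 hε (z - t)).1 (by
        change ψ (z - t) = 0
        rw [map_sub, htz, sub_self])
    rw [← add_sub_cancel t z]
    exact Submodule.add_mem_sup ht this

end TensorComplex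

/-! ### Reduction to the diagonal and Auslander's rigidity theorem -/

section Diagonal

theorem isWeaklyRegular_X (K : Type*) [Field K] (n : ℕ) :
    RingTheory.Sequence.IsWeaklyRegular (MvPolynomial (Fin n) K)
      (List.ofFn (MvPolynomial.X : Fin n → MvPolynomial (Fin n) K)) := by
  classical
  refine ⟨fun i hi => ?_⟩
  have hin : i < n := by simpa using hi
  -- The ideal of the first `i` variables is monomial: membership means that every monomial of `f`
  -- involves one of them. Multiplication by the next variable does not affect this.
  have key : ∀ f : MvPolynomial (Fin n) K,
      f ∈ (Ideal.ofList ((List.ofFn (MvPolynomial.X : Fin n → MvPolynomial (Fin n) K)).take i) • ⊤ :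
        Submodule (MvPolynomial (Fin n) K) (MvPolynomial (Fin n) K)) ↔
      ∀ m ∈ f.support, ∃ j ∈ {j : Fin n | (j : ℕ) < i}, m j ≠ 0 := by
    intro f
    rw [← MvPolynomial.mem_ideal_span_X_image, smul_eq_mul, Ideal.mul_top, Ideal.ofList]
    congr! 2
    ext g
    simp only [Set.mem_ofPred_eq, List.mem_take_iff_getElem, Set.mem_image, List.getElem_ofFn,
      List.length_ofFn, lt_min_iff]
    constructor
    · rintro ⟨j, hj, rfl⟩
      exact ⟨⟨j, hj.2⟩, hj.1, rfl⟩
    · rintro ⟨j, hj, rfl⟩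
      exact ⟨j, ⟨hj, j.2⟩, rfl⟩
  rw [isSMulRegular_iff_right_eq_zero_of_smul]
  intro x hx
  obtain ⟨f, rfl⟩ := Submodule.mkQ_surjective _ x
  rw [← map_smul, Submodule.mkQ_apply, Submodule.Quotient.mk_eq_zero, key] at hx
  rw [Submodule.mkQ_apply, Submodule.Quotient.mk_eq_zero, key]
  intro m hm
  obtain ⟨j, hj, hmj⟩ := hx (m + Finsupp.single ⟨i, hin⟩ 1) (by
    rw [List.getElem_ofFn, smul_eq_mul, mul_comm, MvPolynomial.mem_support_iff,
      MvPolynomial.coeff_mul_X]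
    exact MvPolynomial.mem_support_iff.1 hm)
  refine ⟨j, hj, ?_⟩
  have hj : (j : ℕ) < i := hj
  have hne : j ≠ ⟨i, hin⟩ := by
    rintro rfl
    exact lt_irrefl _ hj
  simpa [Finsupp.single_apply, hne.symm] using hmj

attribute [local instance] MvPolynomial.algebraMvPolynomial

variable {K : Type*} [Field K] {n : ℕ} {T : Type*} [CommRing T] [Algebra K T]
  (M : Type*) [AddCommGroup M] [Module K M] [Module T M] [IsScalarTower K T M]

/-- By cancellation of base change `T[t] ⊗_T M` is `S ⊗_K M`, and every module over the field `K` is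
flat. -/
theorem flat_mvPolynomial_tensor :
    Module.Flat (MvPolynomial (Fin n) K) (MvPolynomial (Fin n) T ⊗[T] M) :=
  Module.Flat.of_linearEquiv
    (Algebra.IsPushout.cancelBaseChange K (MvPolynomial (Fin n) K) T (MvPolynomial (Fin n) T) M)

/-- The variables form a regular sequence on `M[t]`. -/
theorem isWeaklyRegular_X_tensor (K : Type*) [Field K] {n : ℕ} {T : Type*} [CommRing T]
    [Algebra K T]
    (M : Type*) [AddCommGroup M] [Module K M] [Module T M] [IsScalarTower K T M] :
    RingTheory.Sequence.IsWeaklyRegular (MvPolynomial (Fin n) T ⊗[T] M)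
      (List.ofFn (MvPolynomial.X : Fin n → MvPolynomial (Fin n) T)) := by
  have := flat_mvPolynomial_tensor (K := K) (n := n) (T := T) M
  have h := ((TensorProduct.rid (MvPolynomial (Fin n) K)
    (MvPolynomial (Fin n) T ⊗[T] M)).isWeaklyRegular_congr _).1
      ((isWeaklyRegular_X K n).isWeaklyRegular_lTensor
        (M₂ := MvPolynomial (Fin n) T ⊗[T] M))
  rw [← RingTheory.Sequence.isWeaklyRegular_map_algebraMap_iff (S := MvPolynomial (Fin n) T)] at h
  convert! h using 1
  rw [List.map_ofFn]
  congr 1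
  funext i
  simp

/-- The automorphism of `T[t]` with `t_i ↦ t_i - c_i`. -/
def translate (c : Fin n → T) : MvPolynomial (Fin n) T ≃ₐ[T] MvPolynomial (Fin n) T :=
  AlgEquiv.ofAlgHom (MvPolynomial.aeval fun i => MvPolynomial.X i - MvPolynomial.C (c i))
    (MvPolynomial.aeval fun i => MvPolynomial.X i + MvPolynomial.C (c i))
    (by ext i; simp [← MvPolynomial.algebraMap_eq]) (by ext i; simp [← MvPolynomial.algebraMap_eq])

/-- The translation of `T[t]` that carries `t_i` to `t_i - c_i` induces an automorphism of `M[t]`,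
which transports regularity of the variables. -/
theorem isWeaklyRegular_X_sub_C_tensor (K : Type*) [Field K] {n : ℕ} {T : Type*} [CommRing T]
    [Algebra K T]
    (M : Type*) [AddCommGroup M] [Module K M] [Module T M] [IsScalarTower K T M]
    (c : Fin n → T) :
    RingTheory.Sequence.IsWeaklyRegular (MvPolynomial (Fin n) T ⊗[T] M)
      (List.ofFn fun i => MvPolynomial.X i - MvPolynomial.C (c i)) := by
  refine (AddEquiv.isWeaklyRegular_congr
    (e := (LinearEquiv.rTensor M (translate c).toLinearEquiv).toAddEquiv) ?_).1
    (isWeaklyRegular_X_tensor K (n := n) M)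
  rw [List.forall₂_iff_get]
  refine ⟨by simp, fun i h1 h2 x => ?_⟩
  simp only [List.get_eq_getElem, List.getElem_ofFn]
  induction x with
  | zero => simp
  | add x y hx hy => rw [smul_add, map_add, hx, hy, map_add, smul_add]
  | tmul r m => simp [TensorProduct.smul_tmul', translate]

theorem sub_C_eval_mem_ofList (c : Fin n → T) (r : MvPolynomial (Fin n) T) :
    r - MvPolynomial.C (MvPolynomial.eval c r) ∈
      Ideal.ofList (List.ofFn fun i => MvPolynomial.X i - MvPolynomial.C (c i)) := by
  induction r using MvPolynomial.induction_on with
  | C a => simp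
  | add p q hp hq =>
    rw [map_add, map_add, add_sub_add_comm]
    exact add_mem hp hq
  | mul_X p i hp =>
    have : p * MvPolynomial.X i - MvPolynomial.C (MvPolynomial.eval c (p * MvPolynomial.X i)) =
        p * (MvPolynomial.X i - MvPolynomial.C (c i)) +
          MvPolynomial.C (c i) * (p - MvPolynomial.C (MvPolynomial.eval c p)) := by
      simp only [map_mul, MvPolynomial.eval_X]
      ring
    rw [this]
    refine add_mem (Ideal.mul_mem_left _ _ (Ideal.subset_span ?_)) (Ideal.mul_mem_left _ _ hp)
    exact List.mem_ofFn.2 ⟨i, rfl⟩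

/-- Evaluation `M[t] → M` at `c`. -/
def evalTensor (c : Fin n → T) : MvPolynomial (Fin n) T ⊗[T] M →ₗ[T] M :=
  TensorProduct.lift ((LinearMap.lsmul T M).comp (MvPolynomial.aeval c).toLinearMap)

variable {M}

@[simp]
theorem evalTensor_tmul (c : Fin n → T) (r : MvPolynomial (Fin n) T) (m : M) :
    evalTensor M c (r ⊗ₜ m) = MvPolynomial.eval c r • m :=
  rfl

theorem evalTensor_smul (c : Fin n → T) (r : MvPolynomial (Fin n) T)
    (x : MvPolynomial (Fin n) T ⊗[T] M) :
    evalTensor M c (r • x) = MvPolynomial.eval c r • evalTensor M c x := by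
  induction x with
  | zero => simp
  | add x y hx hy => rw [smul_add, map_add, hx, hy, map_add, smul_add]
  | tmul r m => simp [TensorProduct.smul_tmul', mul_smul]

/-- Identifies `M[t] / (t - c) M[t]` with `M`: modulo the `t_i - c_i`, each `x` is congruent to the
constant `1 ⊗ x(c)`. -/
theorem evalTensor_eq_zero_iff (c : Fin n → T) (x : MvPolynomial (Fin n) T ⊗[T] M) :
    evalTensor M c x = 0 ↔ x ∈ (Ideal.ofList (List.ofFn fun i => MvPolynomial.X i -
      MvPolynomial.C (c i)) • ⊤ : Submodule (MvPolynomial (Fin n) T) _) := by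
  constructor
  · intro hx
    have key : ∀ x : MvPolynomial (Fin n) T ⊗[T] M, x - 1 ⊗ₜ evalTensor M c x ∈
        (Ideal.ofList (List.ofFn fun i => MvPolynomial.X i -
          MvPolynomial.C (c i)) • ⊤ : Submodule (MvPolynomial (Fin n) T) _) := by
      intro x
      induction x with
      | zero => simp
      | add x y hx hy =>
        rw [map_add, TensorProduct.tmul_add, add_sub_add_comm]
        exact add_mem hx hy
      | tmul r m =>
        have : r ⊗ₜ[T] m - 1 ⊗ₜ evalTensor M c (r ⊗ₜ m) =
            (r - MvPolynomial.C (MvPolynomial.eval c r)) • (1 ⊗ₜ[T] m) := by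
          rw [evalTensor_tmul, ← TensorProduct.smul_tmul, TensorProduct.smul_tmul', smul_eq_mul,
            mul_one, TensorProduct.sub_tmul, MvPolynomial.C_eq_smul_one]
        rw [this]
        exact Submodule.smul_mem_smul (sub_C_eval_mem_ofList c r) trivial
    simpa [hx] using key x
  · intro hx
    refine Submodule.smul_induction_on hx (fun r hr y _ => ?_) fun x y hx hy => ?_
    · rw [evalTensor_smul]
      have : MvPolynomial.eval c r = 0 := by
        have hle : Ideal.ofList (List.ofFn fun i => MvPolynomial.X i - MvPolynomial.C (c i)) ≤
            RingHom.ker (MvPolynomial.eval c) := by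
          refine Ideal.span_le.2 fun f hf => ?_
          obtain ⟨i, rfl⟩ := List.mem_ofFn.1 hf
          simp
        exact hle hr
      rw [this, zero_smul]
    · rw [map_add, hx, hy, add_zero]

/-- Auslander's rigidity theorem for polynomial rings over a field. The first factor is regarded as
a module over a second copy `T` of the ring. -/
theorem hasRigidTensor_of_evaluation [IsNoetherianRing T] [Module.Finite T M]
    [Module (MvPolynomial (Fin n) K) M] (π : T →+* MvPolynomial (Fin n) K)
    (hπ : Function.Surjective π) (hM : ∀ (t : T) (m : M), t • m = π t • m)
    (hK : ∀ a, π (algebraMap K T a) = MvPolynomial.C a) (c : Fin n → T)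
    (hc : ∀ i, π (c i) = MvPolynomial.X i)
    {P : ℕ → Type*} [∀ i, AddCommGroup (P i)] [∀ i, Module (MvPolynomial (Fin n) K) (P i)]
    [∀ i, Module.Flat (MvPolynomial (Fin n) K) (P i)] {L : Type*} [AddCommGroup L]
    [Module (MvPolynomial (Fin n) K) L] [Module.Finite (MvPolynomial (Fin n) K) L]
    {dP : ∀ i, P (i + 1) →ₗ[MvPolynomial (Fin n) K] P i} {ε : P 0 →ₗ[MvPolynomial (Fin n) K] L}
    (hd : ∀ i, Function.Exact (dP (i + 1)) (dP i)) (h0 : Function.Exact (dP 0) ε)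
    (hε : Function.Surjective ε) : HasRigidTensor (MvPolynomial (Fin n) K) M dP := by
  have hflat := flat_mvPolynomial_tensor (K := K) (n := n) (T := T) M
  have h1 := tensorComplex_of_flat (R := MvPolynomial (Fin n) T)
    (X := MvPolynomial (Fin n) T ⊗[T] M) hd h0 hε
  have h2 := tensorComplex_quotient_ofList (fun i x => (hd i).apply_apply_eq_zero x)
    (isWeaklyRegular_X_sub_C_tensor K M c) h1
  -- On `T[t]` the ring `S` acts by `x_i ↦ t_i`; setting `t = c` and applying `π` returns `s`. So
  -- evaluation `M[t] → M` is `S`-linear for this action and the given one on `M`.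
  have hs : ∀ s : MvPolynomial (Fin n) K,
      π (MvPolynomial.eval c (algebraMap _ (MvPolynomial (Fin n) T) s)) = s := by
    intro s
    rw [MvPolynomial.algebraMap_def, MvPolynomial.eval_map]
    induction s using MvPolynomial.induction_on with
    | C a => simp [hK]
    | add p q hp hq => rw [MvPolynomial.eval₂_add, map_add, hp, hq]
    | mul_X p i hp => simp [hp, hc]
  let ψ : MvPolynomial (Fin n) T ⊗[T] M →ₗ[MvPolynomial (Fin n) K] M :=
    { evalTensor M c with
      map_smul' := fun s x => by
        change evalTensor M c (s • x) = s • evalTensor M c x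
        rw [← algebraMap_smul (MvPolynomial (Fin n) T) s x, evalTensor_smul, hM, hs] }
  let I : Submodule (MvPolynomial (Fin n) T) (MvPolynomial (Fin n) T ⊗[T] M) :=
    Ideal.ofList (List.ofFn fun i => MvPolynomial.X i - MvPolynomial.C (c i)) • ⊤
  have hker : LinearMap.ker ψ = I.restrictScalars (MvPolynomial (Fin n) K) := by
    ext x
    exact evalTensor_eq_zero_iff c x
  have hsurj : Function.Surjective ψ := fun m => ⟨1 ⊗ₜ m, by
    change evalTensor M c (1 ⊗ₜ m) = m
    simp⟩
  let e : (MvPolynomial (Fin n) T ⊗[T] M ⧸ I) ≃ₗ[MvPolynomial (Fin n) K] M :=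
    (Submodule.Quotient.restrictScalarsEquiv _ I).symm.trans
      ((Submodule.quotEquivOfEq _ _ hker.symm).trans (ψ.quotKerEquivOfSurjective hsurj))
  refine tensorComplex_of_equiv (π.comp (MvPolynomial.eval c))
    (hπ.comp fun t => ⟨MvPolynomial.C t, by simp⟩) e (fun r x => ?_) h2
  obtain ⟨x, rfl⟩ := Submodule.mkQ_surjective _ x
  change evalTensor M c (r • x) = π (MvPolynomial.eval c r) • evalTensor M c x
  rw [evalTensor_smul, hM]

/-- Auslander's rigidity theorem for polynomial rings over a field. -/
theorem hasRigidTensor_mvPolynomial {M : Type*} [AddCommGroup M] [Module K M]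
    [Module (MvPolynomial (Fin n) K) M] [IsScalarTower K (MvPolynomial (Fin n) K) M]
    [Module.Finite (MvPolynomial (Fin n) K) M]
    {P : ℕ → Type*} [∀ i, AddCommGroup (P i)] [∀ i, Module (MvPolynomial (Fin n) K) (P i)]
    [∀ i, Module.Flat (MvPolynomial (Fin n) K) (P i)] {L : Type*} [AddCommGroup L]
    [Module (MvPolynomial (Fin n) K) L] [Module.Finite (MvPolynomial (Fin n) K) L]
    {dP : ∀ i, P (i + 1) →ₗ[MvPolynomial (Fin n) K] P i} {ε : P 0 →ₗ[MvPolynomial (Fin n) K] L}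
    (hd : ∀ i, Function.Exact (dP (i + 1)) (dP i)) (h0 : Function.Exact (dP 0) ε)
    (hε : Function.Surjective ε) : HasRigidTensor (MvPolynomial (Fin n) K) M dP :=
  -- `T` is now `S` itself. Leaving it abstract before kept apart the two actions of `S` on `S[t]`,
  -- through the constants and through the variables `t`.
  hasRigidTensor_of_evaluation (T := MvPolynomial (Fin n) K) (RingHom.id _) Function.surjective_id
    (fun _ _ => rfl) (fun _ => rfl) MvPolynomial.X (fun _ => rfl) hd h0 hε

end Diagonal

/-! ### Gradings as linear maps to families of homogeneous parts -/

section Gradings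

variable {K : Type*} [Field K] {G : Type*} {V : Type*} [AddCommGroup V] [Module K V]
  {W : Type*} [AddCommGroup W] [Module K W]

/-- A grading, given by the map that sends an element to the family of its homogeneous parts. -/
structure Parts (𝒱 : G → Submodule K V) where
  /-- The family of the homogeneous parts of an element. -/
  parts : V →ₗ[K] G →₀ V
  mem : ∀ v g, parts v g ∈ 𝒱 g
  sum_parts : ∀ v, ((parts v).sum fun _ y => y) = v
  of_mem : ∀ g v, v ∈ 𝒱 g → parts v = Finsupp.single g v

namespace Parts

variable {𝒱 : G → Submodule K V} {𝒲 : G → Submodule K W}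

theorem induction_on (ρ : Parts 𝒱) {motive : V → Prop} (zero : motive 0)
    (add : ∀ x y, motive x → motive y → motive (x + y)) (mem : ∀ g, ∀ v ∈ 𝒱 g, motive v) (v : V) :
    motive v := by
  rw [← ρ.sum_parts v]
  exact Finset.sum_induction _ _ add zero fun g _ => mem g _ (ρ.mem v g)

theorem parts_map (ρ : Parts 𝒱) (σ : Parts 𝒲) (φ : V →+ W) (hφ : ∀ g, ∀ v ∈ 𝒱 g, φ v ∈ 𝒲 g)
    (v : V) : σ.parts (φ v) = (ρ.parts v).mapRange φ (map_zero φ) := by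
  induction v using ρ.induction_on with
  | zero => simp
  | add x y hx hy => rw [map_add, map_add, hx, hy, map_add, Finsupp.mapRange_add (map_add φ)]
  | mem g v hv =>
    rw [ρ.of_mem g v hv, σ.of_mem g _ (hφ g v hv), Finsupp.mapRange_single]

/-- It suffices to have the homogeneous parts of the homogeneous elements. -/
def ofSpan (f : V →ₗ[K] G →₀ V) (hf : ∀ g v, v ∈ 𝒱 g → f v = Finsupp.single g v)
    (h : ⨆ g, 𝒱 g = ⊤) : Parts 𝒱 := by
  classical
  have ind : ∀ {motive : V → Prop} (_ : motive 0)
      (_ : ∀ x y, motive x → motive y → motive (x + y))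
      (_ : ∀ g, ∀ v ∈ 𝒱 g, motive v) (v), motive v := by
    intro motive h0 hadd hg v
    exact Submodule.iSup_induction 𝒱 (motive := motive) (show v ∈ ⨆ g, 𝒱 g from h ▸ trivial)
      hg h0 hadd
  refine ⟨f, ind ?_ ?_ ?_, ind ?_ ?_ ?_, hf⟩
  · simp
  · intro x y hx hy g
    rw [map_add]
    exact add_mem (hx g) (hy g)
  · intro g v hv h
    rw [hf g v hv, Finsupp.single_apply]
    split_ifs with e
    · exact e ▸ hv
    · exact zero_mem _
  · simp
  · intro x y hx hy
    rw [map_add, Finsupp.sum_add_index' (fun _ => rfl) (fun _ _ _ => rfl), hx, hy]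
  · intro g v hv
    rw [hf g v hv, Finsupp.sum_single_index rfl]

/-- A decomposition as a direct sum gives the homogeneous parts. -/
def ofDecomposition [DecidableEq G] (𝒱 : G → Submodule K V) [DirectSum.Decomposition 𝒱] :
    Parts 𝒱 :=
  ofSpan ((DirectSum.toModule K G (G →₀ V) fun g => (Finsupp.lsingle g).comp (𝒱 g).subtype).comp
      (DirectSum.decomposeLinearEquiv 𝒱).toLinearMap)
    (fun g v hv => by
      change DirectSum.toModule K G (G →₀ V) _ (DirectSum.decompose 𝒱 v) = _
      rw [DirectSum.decompose_of_mem 𝒱 hv]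
      exact DirectSum.toModule_lof K g _)
    (DirectSum.Decomposition.isInternal 𝒱).submodule_iSup_eq_top

section Submodules

variable {S : Type*} [CommRing S] [Algebra K S] [Module S V] [IsScalarTower K S V]

/-- The homogeneous parts in a homogeneous submodule. -/
def submodule (ρ : Parts 𝒱) (Z : Submodule S V) (hZ : ∀ z ∈ Z, ∀ g, ρ.parts z g ∈ Z) :
    Parts (fun g => (𝒱 g).comap (Z.subtype.restrictScalars K)) := by
  classical
  refine Parts.ofSpan
    { toFun := fun z => Finsupp.onFinset (ρ.parts z).support (fun g => ⟨ρ.parts z g, hZ z z.2 g⟩)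
        (fun g hg => Finsupp.mem_support_iff.2 fun h => hg (Subtype.ext h))
      map_add' := fun x y => by ext g; simp
      map_smul' := fun c x => by ext g; simp } (fun g z hz => ?_) (eq_top_iff.2 fun z _ => ?_)
  · ext h
    simp only [LinearMap.coe_mk, AddHom.coe_mk, Finsupp.onFinset_apply]
    rw [ρ.of_mem g z hz, Finsupp.single_apply, Finsupp.single_apply]
    split_ifs <;> rfl
  · have : z = ∑ g ∈ (ρ.parts z).support, ⟨ρ.parts z g, hZ z z.2 g⟩ := by
      refine Subtype.ext ?_
      rw [AddSubmonoidClass.coe_finsetSum]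
      exact (ρ.sum_parts z).symm
    rw [this]
    exact sum_mem fun g _ => Submodule.mem_iSup_of_mem g (ρ.mem z g)

/-- The homogeneous parts in the quotient by a homogeneous submodule. -/
def quotient (ρ : Parts 𝒱) (B : Submodule S V) (hB : ∀ z ∈ B, ∀ g, ρ.parts z g ∈ B) :
    Parts (fun g => (𝒱 g).map (B.mkQ.restrictScalars K)) := by
  let f : V →ₗ[K] G →₀ V ⧸ B := (Finsupp.mapRange.linearMap (B.mkQ.restrictScalars K)).comp ρ.parts
  let F : (V ⧸ B) →ₗ[K] G →₀ V ⧸ B :=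
    ((B.restrictScalars K).liftQ f (fun z hz => by
      ext g
      exact (Submodule.Quotient.mk_eq_zero B).2 (hB z hz g))).comp
      (Submodule.Quotient.restrictScalarsEquiv K B).symm.toLinearMap
  have hF : ∀ v, F (B.mkQ v) = (ρ.parts v).mapRange (B.mkQ : V → V ⧸ B) (map_zero _) := fun _ => rfl
  refine ⟨F, fun v g => ?_, fun v => ?_, fun g v hv => ?_⟩
  · obtain ⟨v, rfl⟩ := B.mkQ_surjective v
    rw [hF]
    exact ⟨_, ρ.mem v g, rfl⟩
  · obtain ⟨v, rfl⟩ := B.mkQ_surjective v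
    rw [hF, Finsupp.sum_mapRange_index (fun _ => rfl)]
    conv_rhs => rw [← ρ.sum_parts v]
    exact (map_sum B.mkQ _ _).symm
  · obtain ⟨v, hv, rfl⟩ := hv
    change F (B.mkQ v) = _
    rw [hF, ρ.of_mem g v hv, Finsupp.mapRange_single]
    rfl

end Submodules

end Parts

/-- The homogeneous parts of a polynomial in `K[x]`. -/
def partsX (K : Type*) [Field K] (n : ℕ) : Parts (gradingX K n) := by
  let _ : DirectSum.Decomposition (gradingX K n) :=
    MvPolynomial.weightedDecomposition K (fun _ : Fin n => (1 : ℤ))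
  exact Parts.ofDecomposition _

/-- The bihomogeneous parts of a polynomial in `K[x, y]`. -/
def partsXY (K : Type*) [Field K] (n : ℕ) {m : ℕ} (p : Fin m → ℕ) : Parts (gradingXY K n p) := by
  let _ : DirectSum.Decomposition (gradingXY K n p) := MvPolynomial.weightedDecomposition K
    (Sum.elim (fun _ : Fin n => ((1 : ℤ), (0 : ℤ))) (fun j : Fin m => ((p j : ℤ), (1 : ℤ))))
  exact Parts.ofDecomposition _

section Free

variable {n m : ℕ} (p : Fin m → ℕ) {ι : Type*} (δ : ι → ℤ × ℤ)

theorem single_mem_freeGrading (b : ι) (g : ℤ × ℤ) (a : PolyXY K n m) (ha : a ∈ gradingXY K n p g) :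
    Finsupp.single b a ∈ freeGrading p δ (g + δ b) := by
  classical
  intro b'
  rw [Finsupp.single_apply]
  split_ifs with e
  · subst e
    rwa [add_sub_cancel_right]
  · exact zero_mem _

/-- The bihomogeneous parts in a bigraded free module. -/
def partsFree : Parts (freeGrading (K := K) (n := n) p δ) := by
  classical
  refine Parts.ofSpan (Finsupp.lsum K fun b => (Finsupp.lsum K fun g =>
      (Finsupp.lsingle (g + δ b)).comp (Finsupp.lsingle b)).comp (partsXY K n p).parts) ?_ ?_
  · intro g v hv
    rw [Finsupp.lsum_apply]
    have : ∀ b, ((Finsupp.lsum K fun g => (Finsupp.lsingle (g + δ b)).comp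
        (Finsupp.lsingle b)).comp (partsXY K n p).parts) (v b) =
          Finsupp.lsingle (R := K) g (Finsupp.single b (v b)) := by
      intro b
      rw [LinearMap.comp_apply, (partsXY K n p).of_mem _ _ (hv b)]
      simp
    refine (Finset.sum_congr rfl fun b _ => this b).trans ?_
    rw [← map_sum]
    exact congrArg _ v.sum_single
  · refine eq_top_iff.2 fun v _ => ?_
    induction v using Finsupp.induction_linear with
    | zero => exact zero_mem _
    | add x y hx hy => exact add_mem (hx trivial) (hy trivial)
    | single b a =>
      induction a using (partsXY K n p).induction_on with
      | zero => simp
      | add x y hx hy => rw [Finsupp.single_add]; exact add_mem (hx trivial) (hy trivial)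
      | mem g a ha =>
        exact Submodule.mem_iSup_of_mem (g + δ b) (single_mem_freeGrading p δ b g a ha)

end Free

end Gradings

/-! ### The bigrading of a tensor product -/

section Tensor

variable {K : Type*} [Field K] {n : ℕ}
  {M : Type*} [AddCommGroup M] [Module K M] [Module (PolyX K n) M] [IsScalarTower K (PolyX K n) M]
  {V : Type*} [AddCommGroup V] [Module K V] [Module (PolyX K n) V]

/-- The compatibility of a bigrading with the action of `K[x]`. -/
def IsGradedX (𝒱 : ℤ × ℤ → Submodule K V) : Prop :=
  ∀ a g, ∀ s ∈ gradingX K n a, ∀ v ∈ 𝒱 g, s • v ∈ 𝒱 ((a, 0) + g)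

/-- The homogeneous parts in a tensor product over `K[x]`. -/
theorem exists_tensorParts {ℳ : ℤ → Submodule K M} {𝒱 : ℤ × ℤ → Submodule K V} (μ : Parts ℳ)
    (hℳ : ∀ a b, ∀ s ∈ gradingX K n a, ∀ u ∈ ℳ b, s • u ∈ ℳ (a + b))
    (ν : Parts 𝒱) (h𝒱 : IsGradedX (n := n) 𝒱) :
    Nonempty (Parts (fun g : ℤ × ℤ => Submodule.span K {z : M ⊗[PolyX K n] V | ∃ a b : ℤ,
      a + b = g.1 ∧ ∃ u ∈ ℳ a, ∃ v ∈ 𝒱 (b, g.2), z = u ⊗ₜ[PolyX K n] v})) := by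
  let Y := (ℤ × ℤ) →₀ M ⊗[PolyX K n] V
  -- `B` puts `u ⊗ v` into degree `(a, 0) + g` for `u` of degree `a` and `v` of degree `g`. It is
  -- built as a biadditive map and descends to the tensor product by `hbal`; `K`-linearity is
  -- recovered in `hfK`.
  let B : M →+ V →+ Y := (Finsupp.liftAddHom fun a : ℤ =>
    { toFun := fun u => (Finsupp.liftAddHom fun g : ℤ × ℤ =>
        (Finsupp.singleAddHom ((a, 0) + g)).comp
        (TensorProduct.mk (PolyX K n) M V u).toAddMonoidHom).comp ν.parts.toAddMonoidHom
      map_zero' := by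
        ext v : 1
        change ((ν.parts v).sum fun g y => Finsupp.single ((a, 0) + g) ((0 : M) ⊗ₜ y)) = 0
        simp
      map_add' := fun u u' => by
        ext v : 1
        change ((ν.parts v).sum fun g y => Finsupp.single ((a, 0) + g) ((u + u') ⊗ₜ y)) =
          ((ν.parts v).sum fun g y => Finsupp.single ((a, 0) + g) (u ⊗ₜ y)) +
            ((ν.parts v).sum fun g y => Finsupp.single ((a, 0) + g) (u' ⊗ₜ y))
        rw [← Finsupp.sum_add]
        simp only [TensorProduct.add_tmul, Finsupp.single_add] }).comp μ.parts.toAddMonoidHom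
  have hB : ∀ a g, ∀ u ∈ ℳ a, ∀ v ∈ 𝒱 g, B u v = Finsupp.single ((a, 0) + g) (u ⊗ₜ v) := by
    intro a g u hu v hv
    simp only [B, AddMonoidHom.comp_apply, LinearMap.toAddMonoidHom_coe]
    rw [μ.of_mem a u hu]
    simp [ν.of_mem g v hv]
  have hbal : ∀ (s : PolyX K n) m v, B (s • m) v = B m (s • v) := by
    intro s m v
    induction s using (partsX K n).induction_on with
    | zero => simp
    | add x y hx hy => simp only [add_smul, map_add, AddMonoidHom.add_apply, hx, hy]
    | mem c s hs =>
      induction m using μ.induction_on with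
      | zero => simp
      | add x y hx hy => simp only [smul_add, map_add, AddMonoidHom.add_apply, hx, hy]
      | mem a u hu =>
        induction v using ν.induction_on with
        | zero => simp
        | add x y hx hy => simp only [smul_add, map_add, hx, hy]
        | mem g v hv =>
          rw [hB _ _ _ (hℳ c a s hs u hu) _ hv, hB _ _ _ hu _ (h𝒱 c g s hs v hv),
            TensorProduct.smul_tmul, ← add_assoc]
          congr 2
          ext <;> simp [add_comm]
  let f := TensorProduct.liftAddHom B hbal
  have hf : ∀ a g, ∀ u ∈ ℳ a, ∀ v ∈ 𝒱 g, f (u ⊗ₜ v) = Finsupp.single ((a, 0) + g) (u ⊗ₜ v) := hB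
  have hfK : ∀ (c : K) z, f (c • z) = c • f z := by
    intro c z
    induction z with
    | zero => simp
    | add x y hx hy => rw [smul_add, map_add, hx, hy, map_add, smul_add]
    | tmul m v =>
      induction m using μ.induction_on with
      | zero => simp
      | add x y hx hy => rw [TensorProduct.add_tmul, smul_add, map_add, hx, hy, map_add, smul_add]
      | mem a u hu =>
        induction v using ν.induction_on with
        | zero => simp
        | add x y hx hy => rw [TensorProduct.tmul_add, smul_add, map_add, hx, hy, map_add, smul_add]
        | mem g v hv =>
          rw [TensorProduct.smul_tmul', hf a g _ (Submodule.smul_mem _ c hu) v hv, hf a g u hu v hv,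
            Finsupp.smul_single, TensorProduct.smul_tmul']
  refine ⟨Parts.ofSpan { f with map_smul' := hfK } (fun g z hz => ?_) (eq_top_iff.2 fun z _ => ?_)⟩
  · change f z = _
    induction hz using Submodule.span_induction with
    | zero => simp
    | add x y _ _ hx hy => rw [map_add, hx, hy, Finsupp.single_add]
    | smul c x _ hx => rw [hfK, hx, Finsupp.smul_single]
    | mem x hx =>
      obtain ⟨a, b, hab, u, hu, v, hv, rfl⟩ := hx
      rw [hf a _ u hu v hv]
      congr 1
      ext <;> simp [hab]
  · induction z with
    | zero => exact zero_mem _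
    | add x y hx hy => exact add_mem (hx trivial) (hy trivial)
    | tmul m v =>
      induction m using μ.induction_on with
      | zero => simp
      | add x y hx hy => rw [TensorProduct.add_tmul]; exact add_mem (hx trivial) (hy trivial)
      | mem a u hu =>
        induction v using ν.induction_on with
        | zero => simp
        | add x y hx hy => rw [TensorProduct.tmul_add]; exact add_mem (hx trivial) (hy trivial)
        | mem g v hv =>
          exact Submodule.mem_iSup_of_mem (a + g.1, g.2)
            (Submodule.subset_span ⟨a, g.1, rfl, u, hu, v, hv, rfl⟩)

end Tensor

/-! ### The `S`-linear projection onto the part of second degree `k` -/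

section Projection

variable {K : Type*} [Field K] {n : ℕ}
  {V : Type*} [AddCommGroup V] [Module K V] [Module (PolyX K n) V]
  {W : Type*} [AddCommGroup W] [Module K W] [Module (PolyX K n) W]
  {𝒱 : ℤ × ℤ → Submodule K V} {𝒲 : ℤ × ℤ → Submodule K W}

/-- The sum of the parts of second degree `k`. -/
def Parts.projK (ν : Parts 𝒱) (k : ℤ) : V →ₗ[K] V :=
  (Finsupp.lsum K fun g : ℤ × ℤ => if g.2 = k then LinearMap.id else 0).comp ν.parts

theorem Parts.projK_of_mem (ν : Parts 𝒱) (k : ℤ) (g : ℤ × ℤ) (v : V) (hv : v ∈ 𝒱 g) :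
    ν.projK k v = if g.2 = k then v else 0 := by
  rw [projK, LinearMap.comp_apply, ν.of_mem g v hv, Finsupp.lsum_single]
  split_ifs <;> rfl

/-- The projection `X → X_k`. -/
def Parts.proj (ν : Parts 𝒱) (h𝒱 : IsGradedX (n := n) 𝒱) (k : ℤ) : V →ₗ[PolyX K n] V :=
  { ν.projK k with
    map_smul' := fun s v => by
      change ν.projK k (s • v) = s • ν.projK k v
      induction s using (partsX K n).induction_on with
      | zero => simp
      | add x y hx hy => simp only [add_smul, map_add, hx, hy]
      | mem a s hs =>
        induction v using ν.induction_on with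
        | zero => simp
        | add x y hx hy => simp only [smul_add, map_add, hx, hy]
        | mem g v hv =>
          rw [ν.projK_of_mem k g v hv, ν.projK_of_mem k _ _ (h𝒱 a g s hs v hv)]
          simp }

variable (ν : Parts 𝒱) (h𝒱 : IsGradedX (n := n) 𝒱) (k : ℤ)

theorem Parts.proj_of_mem (g : ℤ × ℤ) (v : V) (hv : v ∈ 𝒱 g) :
    ν.proj h𝒱 k v = if g.2 = k then v else 0 :=
  ν.projK_of_mem k g v hv

theorem Parts.proj_mem_component (v : V) : ν.proj h𝒱 k v ∈ component n 𝒱 k := by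
  induction v using ν.induction_on with
  | zero => simp
  | add x y hx hy => rw [map_add]; exact add_mem hx hy
  | mem g v hv =>
    rw [ν.proj_of_mem h𝒱 k g v hv]
    split_ifs with h
    · subst h
      exact Submodule.subset_span (Set.mem_iUnion.2 ⟨g.1, hv⟩)
    · exact zero_mem _

theorem Parts.proj_of_mem_component {v : V} (hv : v ∈ component n 𝒱 k) : ν.proj h𝒱 k v = v := by
  have : component n 𝒱 k ≤ LinearMap.eqLocus (ν.proj h𝒱 k) LinearMap.id := by
    refine Submodule.span_le.2 fun v hv => ?_
    obtain ⟨c, hc⟩ := Set.mem_iUnion.1 hv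
    exact (ν.proj_of_mem h𝒱 k (c, k) v hc).trans (if_pos rfl)
  exact this hv

theorem Parts.map_proj (σ : Parts 𝒲) (h𝒲 : IsGradedX (n := n) 𝒲) (φ : V →+ W)
    (hφ : ∀ g, ∀ v ∈ 𝒱 g, φ v ∈ 𝒲 g) (v : V) :
    φ (ν.proj h𝒱 k v) = σ.proj h𝒲 k (φ v) := by
  induction v using ν.induction_on with
  | zero => simp
  | add x y hx hy => simp only [map_add, hx, hy]
  | mem g v hv =>
    rw [ν.proj_of_mem h𝒱 k g v hv, σ.proj_of_mem h𝒲 k g _ (hφ g v hv)]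
    split_ifs <;> simp

/-- The homogeneous parts in `X_k`. -/
theorem Parts.exists_component [IsScalarTower K (PolyX K n) V] (ν : Parts 𝒱)
    (h𝒱 : IsGradedX (n := n) 𝒱) (k : ℤ) : Nonempty (Parts (fun c : ℤ =>
      (𝒱 (c, k)).comap ((component n 𝒱 k).subtype.restrictScalars K))) := by
  have hmem : ∀ (v : V) (c : ℤ), ν.parts v (c, k) ∈ component n 𝒱 k := fun v c =>
    Submodule.subset_span (Set.mem_iUnion.2 ⟨c, ν.mem v (c, k)⟩)
  have hinj : Function.Injective fun c : ℤ => (c, k) := fun a b h => congrArg Prod.fst h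
  let f : V →ₗ[K] ℤ →₀ V := (Finsupp.lcomapDomain _ hinj).comp ν.parts
  have hf : ∀ v c, f v c = ν.parts v (c, k) := fun _ _ => rfl
  refine ⟨Parts.ofSpan
    { toFun := fun z => Finsupp.onFinset (f z).support (fun c => ⟨f z c, hmem z c⟩)
        (fun g hg => Finsupp.mem_support_iff.2 fun h => hg (Subtype.ext h))
      map_add' := fun x y => by ext g; simp
      map_smul' := fun c x => by ext g; simp } (fun c z hz => ?_) (eq_top_iff.2 fun z _ => ?_)⟩
  · ext h
    simp only [LinearMap.coe_mk, AddHom.coe_mk, Finsupp.onFinset_apply]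
    rw [hf, ν.of_mem (c, k) z hz]
    by_cases e : c = h
    · subst e
      simp
    · rw [Finsupp.single_eq_of_ne (fun h' => e (congrArg Prod.fst h').symm),
        Finsupp.single_eq_of_ne (Ne.symm e)]
      rfl
  · have key : ∀ v, ((f v).sum fun _ y => y) = ν.proj h𝒱 k v := by
      intro v
      induction v using ν.induction_on with
      | zero => simp
      | add x y hx hy =>
        rw [map_add, Finsupp.sum_add_index' (fun _ => rfl) (fun _ _ _ => rfl), hx, hy, map_add]
      | mem g v hv =>
        rw [ν.proj_of_mem h𝒱 k g v hv]
        split_ifs with h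
        · have : f v = Finsupp.single g.1 v := by
            ext c
            rw [hf, ν.of_mem g v hv]
            by_cases e : g.1 = c
            · subst e
              subst h
              simp
            · rw [Finsupp.single_eq_of_ne (fun h' => e (congrArg Prod.fst h').symm),
                Finsupp.single_eq_of_ne (Ne.symm e)]
          rw [this, Finsupp.sum_single_index rfl]
        · have : f v = 0 := by
            ext c
            rw [hf, ν.of_mem g v hv,
              Finsupp.single_eq_of_ne (fun h' => h (congrArg Prod.snd h').symm)]
            rfl
          rw [this, Finsupp.sum_zero_index]
    have : z = ∑ c ∈ (f z).support, ⟨f z c, hmem z c⟩ := by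
      refine Subtype.ext ?_
      rw [AddSubmonoidClass.coe_finsetSum]
      exact ((key z).trans (ν.proj_of_mem_component h𝒱 k z.2)).symm
    rw [this]
    exact sum_mem fun c _ => Submodule.mem_iSup_of_mem c (ν.mem z (c, k))

end Projection

/-! ### Homology of the part of second degree `k` -/

section HomologyGrading

variable {K : Type*} [Field K] {n : ℕ}
  {V : Type*} [AddCommGroup V] [Module K V] [Module (PolyX K n) V] [IsScalarTower K (PolyX K n) V]

/-- The grading of the subquotient `Z / B`. -/
def subquotientGrading {G : Type*} (𝒱 : G → Submodule K V) (Z B : Submodule (PolyX K n) V) (g : G) :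
    Submodule K (Z ⧸ B.submoduleOf Z) :=
  ((𝒱 g).comap (Z.subtype.restrictScalars K)).map ((B.submoduleOf Z).mkQ.restrictScalars K)

/-- The homogeneous parts in a subquotient. -/
def Parts.subquotient {G : Type*} {𝒱 : G → Submodule K V} (ν : Parts 𝒱)
    (Z B : Submodule (PolyX K n) V) (hZ : ∀ z ∈ Z, ∀ g, ν.parts z g ∈ Z)
    (hB : ∀ z ∈ B, ∀ g, ν.parts z g ∈ B) : Parts (subquotientGrading 𝒱 Z B) :=
  (ν.submodule Z hZ).quotient (B.submoduleOf Z) fun z hz g => hB z hz g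

variable {𝒱 : ℤ × ℤ → Submodule K V}

theorem IsGradedX.submodule (h : IsGradedX (n := n) 𝒱) (Z : Submodule (PolyX K n) V) :
    IsGradedX (n := n) (fun g => (𝒱 g).comap (Z.subtype.restrictScalars K)) :=
  fun a g s hs v hv => h a g s hs v hv

theorem IsGradedX.subquotient (h : IsGradedX (n := n) 𝒱) (Z B : Submodule (PolyX K n) V) :
    IsGradedX (n := n) (subquotientGrading 𝒱 Z B) := by
  rintro a g s hs _ ⟨v, hv, rfl⟩
  exact ⟨s • v, h a g s hs v hv, rfl⟩

/-- `V'` is a model of `V_k`: `j` embeds it, and `r` retracts onto it so that `j ∘ r` is the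
projection. Both respect cycles and boundaries, so `Z' / B'` embeds in `Z / B`, with image the part
of degree `k`. It is meant for `M ⊗ (F_i)_k`, which is not literally a submodule of `M ⊗ F_i`. -/
theorem exists_equiv_component_subquotient (ν : Parts 𝒱) (h𝒱 : IsGradedX (n := n) 𝒱) (k : ℤ)
    (Z B : Submodule (PolyX K n) V) (hZ : ∀ z ∈ Z, ∀ g, ν.parts z g ∈ Z)
    (hB : ∀ z ∈ B, ∀ g, ν.parts z g ∈ B)
    {V' : Type*} [AddCommGroup V'] [Module (PolyX K n) V'] (Z' B' : Submodule (PolyX K n) V')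
    (j : V' →ₗ[PolyX K n] V) (r : V →ₗ[PolyX K n] V') (hrj : ∀ x, r (j x) = x)
    (hjr : ∀ x, j (r x) = ν.proj h𝒱 k x) (hjZ : ∀ z ∈ Z', j z ∈ Z) (hjB : ∀ z ∈ B', j z ∈ B)
    (hrZ : ∀ z ∈ Z, r z ∈ Z') (hrB : ∀ z ∈ B, r z ∈ B') :
    Nonempty ((Z' ⧸ B'.submoduleOf Z') ≃ₗ[PolyX K n]
      component n (subquotientGrading 𝒱 Z B) k) := by
  let α : (Z' ⧸ B'.submoduleOf Z') →ₗ[PolyX K n] (Z ⧸ B.submoduleOf Z) :=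
    Submodule.mapQ _ _ (j.restrict hjZ) fun z hz => hjB z hz
  have hα : ∀ z, α (Submodule.mkQ _ z) = Submodule.mkQ _ (j.restrict hjZ z) := fun _ => rfl
  have hinj : Function.Injective α := by
    rw [injective_iff_map_eq_zero]
    intro x hx
    obtain ⟨z, rfl⟩ := Submodule.mkQ_surjective _ x
    rw [hα, Submodule.mkQ_apply, Submodule.Quotient.mk_eq_zero] at hx
    have h1 : j z ∈ B := hx
    rw [Submodule.mkQ_apply, Submodule.Quotient.mk_eq_zero]
    change (z : V') ∈ B'
    rw [← hrj z]
    exact hrB _ h1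
  have hrange : LinearMap.range α = component n (subquotientGrading 𝒱 Z B) k := by
    refine le_antisymm ?_ ?_
    · rintro _ ⟨x, rfl⟩
      obtain ⟨z, rfl⟩ := Submodule.mkQ_surjective _ x
      rw [hα]
      let w := j.restrict hjZ z
      let ν' := ν.submodule Z hZ
      have h𝒱' := h𝒱.submodule Z
      have h1 : ν'.proj h𝒱' k w = w := by
        refine Subtype.ext ?_
        refine (ν'.map_proj h𝒱' k ν h𝒱 Z.subtype.toAddMonoidHom (fun g v hv => hv) w).trans ?_
        change ν.proj h𝒱 k (j z) = j z
        rw [← hjr, hrj]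
      have h2 := ν'.map_proj h𝒱' k (ν.subquotient Z B hZ hB) (h𝒱.subquotient Z B)
        (B.submoduleOf Z).mkQ.toAddMonoidHom (fun g v hv => ⟨v, hv, rfl⟩) w
      rw [h1] at h2
      change (B.submoduleOf Z).mkQ w ∈ _
      change (B.submoduleOf Z).mkQ w = _ at h2
      rw [h2]
      exact Parts.proj_mem_component _ _ _ _
    · refine Submodule.span_le.2 fun x hx => ?_
      obtain ⟨c, z, hz, rfl⟩ := Set.mem_iUnion.1 hx
      have hz : (z : V) ∈ 𝒱 (c, k) := hz
      refine ⟨Submodule.mkQ _ ⟨r z, hrZ z z.2⟩, ?_⟩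
      rw [hα]
      change (B.submoduleOf Z).mkQ _ = (B.submoduleOf Z).mkQ z
      congr 1
      refine Subtype.ext ?_
      change j (r z) = z
      rw [hjr, ν.proj_of_mem h𝒱 k (c, k) z hz, if_pos rfl]
  exact ⟨(LinearEquiv.ofInjective α hinj).trans (LinearEquiv.ofEq _ _ hrange)⟩

end HomologyGrading

/-! ### Flatness of the components of bigraded free modules -/

section FreeModules

variable {K : Type*} [Field K] {n m : ℕ}

theorem free_polyXY : Module.Free (PolyX K n) (PolyXY K n m) := by
  let e : PolyXY K n m ≃ₐ[K] MvPolynomial (Fin m) (PolyX K n) :=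
    (MvPolynomial.renameEquiv K (Equiv.sumComm (Fin n) (Fin m))).trans
      (MvPolynomial.sumAlgEquiv K (Fin m) (Fin n))
  have he : ∀ s : PolyX K n, e (algebraMap _ _ s) = MvPolynomial.C s := by
    intro s
    change e (MvPolynomial.rename Sum.inl s) = _
    induction s using MvPolynomial.induction_on with
    | C a => simp [e]
    | add p q hp hq => rw [map_add, map_add, hp, hq, map_add]
    | mul_X p i hp => rw [map_mul, map_mul, hp, map_mul]; simp [e]
  let e' : PolyXY K n m ≃ₗ[PolyX K n] MvPolynomial (Fin m) (PolyX K n) :=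
    { e with
      map_smul' := fun s a => by
        change e (s • a) = s • e a
        rw [Algebra.smul_def, map_mul, he, MvPolynomial.smul_eq_C_mul] }
  exact Module.Free.of_equiv e'.symm

theorem algebraMap_mem_gradingXY (p : Fin m → ℕ) (a : ℤ) (s : PolyX K n)
    (hs : s ∈ gradingX K n a) : algebraMap _ (PolyXY K n m) s ∈ gradingXY K n p (a, 0) := by
  change MvPolynomial.rename Sum.inl s ∈ _
  intro d hd
  obtain ⟨d, rfl, hd'⟩ := MvPolynomial.coeff_rename_ne_zero _ _ _ hd
  have hw : ∑ i ∈ d.support, d i • (1 : ℤ) = a := hs hd'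
  rw [Finsupp.weight_apply, Finsupp.sum_mapDomain_index (by simp) (by simp [add_smul]), Finsupp.sum]
  refine Prod.ext ?_ ?_
  · rw [Prod.fst_sum, ← hw]
    simp
  · rw [Prod.snd_sum]
    simp

variable {p : Fin m → ℕ}

theorem isGradedX_freeGrading {ι : Type*} (δ : ι → ℤ × ℤ) :
    IsGradedX (n := n) (freeGrading (K := K) (n := n) p δ) := by
  intro a g s hs v hv
  rw [← algebraMap_smul (PolyXY K n m) s v]
  exact smul_mem_freeGrading p δ _ _ _ _ (algebraMap_mem_gradingXY p a s hs) hv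

theorem isGradedX_of_gradedSMul {N : Type*} [AddCommGroup N] [Module K N] [Module (PolyX K n) N]
    [Module (PolyXY K n m) N] [IsScalarTower (PolyX K n) (PolyXY K n m) N]
    (𝒩 : ℤ × ℤ → Submodule K N) [SetLike.GradedSMul (gradingXY K n p) 𝒩] :
    IsGradedX (n := n) 𝒩 := by
  intro a g s hs v hv
  rw [← algebraMap_smul (PolyXY K n m) s v]
  exact SetLike.GradedSMul.smul_mem (algebraMap_mem_gradingXY p a s hs) hv

/-- The projection makes the component a retract of the whole free `A`-module, which is free over
`S` because `A = S[y]` is. -/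
theorem flat_component_freeGrading {ι : Type*} (δ : ι → ℤ × ℤ) (k : ℤ) :
    Module.Flat (PolyX K n) (component n (freeGrading (K := K) (n := n) p δ) k) := by
  have := free_polyXY (K := K) (n := n) (m := m)
  have h := isGradedX_freeGrading (K := K) (n := n) (p := p) δ
  let e := ((partsFree p δ).proj h k).codRestrict _ ((partsFree p δ).proj_mem_component h k)
  exact Module.Flat.of_retract (component n (freeGrading (K := K) (n := n) p δ) k).subtype e (by
    ext x : 1
    exact Subtype.ext ((partsFree p δ).proj_of_mem_component h k x.2))

end FreeModules

/-! ### The resolution of `N_k` and the components of Tor -/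

section Resolutions

variable {K : Type*} [Field K] {n m : ℕ} {p : Fin m → ℕ}
  {N : Type*} [AddCommGroup N] [Module K N] [Module (PolyXY K n m) N]
  {𝒩 : ℤ × ℤ → Submodule K N}

theorem map_mem_component {V W : Type*} [AddCommGroup V] [Module K V] [Module (PolyX K n) V]
    [AddCommGroup W] [Module K W] [Module (PolyX K n) W] {𝒱 : ℤ × ℤ → Submodule K V}
    {𝒲 : ℤ × ℤ → Submodule K W} (φ : V →ₗ[PolyX K n] W) (hφ : ∀ g, ∀ v ∈ 𝒱 g, φ v ∈ 𝒲 g) (k : ℤ) :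
    ∀ v ∈ component n 𝒱 k, φ v ∈ component n 𝒲 k := by
  have : component n 𝒱 k ≤ (component n 𝒲 k).comap φ := by
    refine Submodule.span_le.2 fun v hv => ?_
    obtain ⟨c, hc⟩ := Set.mem_iUnion.1 hv
    exact Submodule.subset_span (Set.mem_iUnion.2 ⟨c, hφ _ v hc⟩)
  exact this

namespace BigradedFreeResolution

variable (F : BigradedFreeResolution n p 𝒩) (k : ℤ)

/-- The differential of the resolution of `N_k` by the components of the free modules. -/
def dComponent (i : ℕ) :
    component n (freeGrading (K := K) (n := n) p (F.deg (i + 1))) k →ₗ[PolyX K n]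
    component n (freeGrading (K := K) (n := n) p (F.deg i)) k :=
  ((F.d i).restrictScalars (PolyX K n)).restrict (map_mem_component _ (F.d_mem i) k)

/-- A preimage in the full resolution may be replaced by its projection to second degree `k`,
because the projections commute with the differential. -/
theorem exact_dComponent (i : ℕ) : Function.Exact (F.dComponent k (i + 1)) (F.dComponent k i) := by
  intro x
  constructor
  · intro hx
    have hx : F.d i x = 0 := congrArg Subtype.val hx
    obtain ⟨y, hy⟩ := (F.exact_d i x).1 hx
    let ν := partsFree (K := K) (n := n) p (F.deg (i + 1 + 1))
    have hν := isGradedX_freeGrading (K := K) (n := n) (p := p) (F.deg (i + 1 + 1))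
    refine ⟨⟨ν.proj hν k y, ν.proj_mem_component hν k y⟩, Subtype.ext ?_⟩
    refine (ν.map_proj hν k (partsFree p (F.deg (i + 1))) (isGradedX_freeGrading _)
      (F.d (i + 1)).toAddMonoidHom (F.d_mem (i + 1)) y).trans ?_
    change Parts.proj _ _ _ (F.d (i + 1) y) = _
    rw [hy]
    exact Parts.proj_of_mem_component _ _ _ x.2
  · rintro ⟨y, rfl⟩
    exact Subtype.ext ((F.exact_d i).apply_apply_eq_zero y)

section Augmentation

variable [Module (PolyX K n) N] [IsScalarTower (PolyX K n) (PolyXY K n m) N]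

/-- The augmentation of the resolution of `N_k` by the components of the free modules. -/
def augComponent : component n (freeGrading (K := K) (n := n) p (F.deg 0)) k →ₗ[PolyX K n]
    component n 𝒩 k :=
  (F.aug.restrictScalars (PolyX K n)).restrict (map_mem_component _ F.aug_mem k)

theorem exact_augComponent : Function.Exact (F.dComponent k 0) (F.augComponent k) := by
  intro x
  constructor
  · intro hx
    have hx : F.aug x = 0 := congrArg Subtype.val hx
    obtain ⟨y, hy⟩ := (F.exact_aug x).1 hx
    let ν := partsFree (K := K) (n := n) p (F.deg 1)
    have hν := isGradedX_freeGrading (K := K) (n := n) (p := p) (F.deg 1)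
    refine ⟨⟨ν.proj hν k y, ν.proj_mem_component hν k y⟩, Subtype.ext ?_⟩
    refine (ν.map_proj hν k (partsFree p (F.deg 0)) (isGradedX_freeGrading _)
      (F.d 0).toAddMonoidHom (F.d_mem 0) y).trans ?_
    change Parts.proj _ _ _ (F.d 0 y) = _
    rw [hy]
    exact Parts.proj_of_mem_component _ _ _ x.2
  · rintro ⟨y, rfl⟩
    exact Subtype.ext (F.exact_aug.apply_apply_eq_zero y)

theorem augComponent_surjective (ν : Parts 𝒩) (hν : IsGradedX (n := n) 𝒩) :
    Function.Surjective (F.augComponent k) := by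
  intro x
  obtain ⟨y, hy⟩ := F.aug_surjective x
  let ν' := partsFree (K := K) (n := n) p (F.deg 0)
  have hν' := isGradedX_freeGrading (K := K) (n := n) (p := p) (F.deg 0)
  refine ⟨⟨ν'.proj hν' k y, ν'.proj_mem_component hν' k y⟩, Subtype.ext ?_⟩
  refine (ν'.map_proj hν' k ν hν F.aug.toAddMonoidHom F.aug_mem y).trans ?_
  change Parts.proj _ _ _ (F.aug y) = _
  rw [hy]
  exact Parts.proj_of_mem_component _ _ _ x.2

end Augmentation

variable {M : Type*} [AddCommGroup M] [Module K M] [Module (PolyX K n) M]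
  [IsScalarTower K (PolyX K n) M] {ℳ : ℤ → Submodule K M}

theorem isGradedX_tensorGrading (hℳ : ∀ a b, ∀ s ∈ gradingX K n a, ∀ u ∈ ℳ b, s • u ∈ ℳ (a + b))
    (i : ℕ) : IsGradedX (n := n) (F.tensorGrading ℳ i) := by
  intro a g s hs z hz
  induction hz using Submodule.span_induction with
  | zero => rw [smul_zero]; exact zero_mem _
  | add x y _ _ hx hy => rw [smul_add]; exact add_mem hx hy
  | smul c x _ hx => rw [smul_comm]; exact Submodule.smul_mem _ c hx
  | mem x hx =>
    obtain ⟨b, b', hb, u, hu, v, hv, rfl⟩ := hx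
    rw [TensorProduct.smul_tmul']
    exact Submodule.subset_span ⟨a + b, b', by rw [add_assoc, hb]; rfl, s • u, hℳ a b s hs u hu, v,
      by rwa [Prod.snd_add, zero_add], rfl⟩

theorem tensorD_mem (i : ℕ) (g : ℤ × ℤ) (z : F.tensor M (i + 1))
    (hz : z ∈ F.tensorGrading ℳ (i + 1) g) : F.tensorD M i z ∈ F.tensorGrading ℳ i g := by
  have : F.tensorGrading ℳ (i + 1) g ≤
      (F.tensorGrading ℳ i g).comap ((F.tensorD M i).restrictScalars K) := by
    refine Submodule.span_le.2 ?_
    rintro _ ⟨a, b, hab, u, hu, v, hv, rfl⟩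
    exact Submodule.subset_span ⟨a, b, hab, u, hu, F.d i v, F.d_mem i _ v hv, rfl⟩
  exact this hz

variable (M) in
/-- The differential of the complex `(M ⊗ F)_k`. -/
abbrev tensorDComponent (i : ℕ) :
    M ⊗[PolyX K n] component n (freeGrading (K := K) (n := n) p (F.deg (i + 1))) k →ₗ[PolyX K n]
      M ⊗[PolyX K n] component n (freeGrading (K := K) (n := n) p (F.deg i)) k :=
  tensorComplex (S := PolyX K n) (P := fun i =>
    component n (freeGrading (K := K) (n := n) p (F.deg i)) k) (PolyX K n) M (F.dComponent k) i

/-- Taking parts of second degree `k` commutes with homology, as the differential of `M ⊗ F`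
preserves degrees. The bridge from Tor(M, N)_k to the ungraded rigidity theorem for the resolution
of `N_k`. -/
theorem exists_equiv_torComponent (μ : Parts ℳ)
    (hℳ : ∀ a b, ∀ s ∈ gradingX K n a, ∀ u ∈ ℳ b, s • u ∈ ℳ (a + b)) (i : ℕ) :
    Nonempty (Parts (F.torGrading ℳ i)) ∧
    Nonempty (chainHomology (C := fun i => M ⊗[PolyX K n]
      component n (freeGrading (K := K) (n := n) p (F.deg i)) k)
      (F.tensorDComponent k M) i ≃ₗ[PolyX K n] F.torComponent ℳ i k) := by
  let τ : ∀ i, Parts (F.tensorGrading ℳ i) := fun i => (exists_tensorParts μ hℳ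
    (partsFree (K := K) (n := n) p (F.deg i)) (isGradedX_freeGrading _)).some
  have hτ := F.isGradedX_tensorGrading hℳ
  have hd : ∀ i z g, (τ i).parts (F.tensorD M i z) g = F.tensorD M i ((τ (i + 1)).parts z g) :=
    fun i z g => DFunLike.congr_fun
      ((τ (i + 1)).parts_map (τ i) (F.tensorD M i).toAddMonoidHom (F.tensorD_mem i) z) g
  have hZ : ∀ z ∈ F.cycles M i, ∀ g, (τ i).parts z g ∈ F.cycles M i := by
    cases i with
    | zero => exact fun _ _ _ => trivial
    | succ i =>
      intro z hz g
      have hz : F.tensorD M i z = 0 := hz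
      change F.tensorD M i _ = 0
      rw [← hd, hz, map_zero, Finsupp.zero_apply]
  have hB : ∀ z ∈ F.boundaries M i, ∀ g, (τ i).parts z g ∈ F.boundaries M i := by
    rintro _ ⟨w, rfl⟩ g
    exact ⟨_, (hd i w g).symm⟩
  refine ⟨⟨(τ i).subquotient (F.cycles M i) (F.boundaries M i) hZ hB⟩, ?_⟩
  let j : ∀ i, M ⊗[PolyX K n] component n (freeGrading (K := K) (n := n) p (F.deg i)) k
      →ₗ[PolyX K n] F.tensor M i := fun i => (Submodule.subtype _).lTensor M
  let e := fun i => ((partsFree (K := K) (n := n) p (F.deg i)).proj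
    (isGradedX_freeGrading (F.deg i)) k).codRestrict _ (Parts.proj_mem_component _ _ k)
  let r : ∀ i, F.tensor M i →ₗ[PolyX K n]
      M ⊗[PolyX K n] component n (freeGrading (K := K) (n := n) p (F.deg i)) k :=
    fun i => (e i).lTensor M
  have hrj : ∀ i x, r i (j i x) = x := by
    intro i x
    induction x with
    | zero => simp
    | add x y hx hy => rw [map_add, map_add, hx, hy]
    | tmul m v =>
      simp only [r, j, LinearMap.lTensor_tmul]
      congr 1
      exact Subtype.ext (Parts.proj_of_mem_component _ _ k v.2)
  have hjr : ∀ i x, j i (r i x) = (τ i).proj (hτ i) k x := by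
    intro i x
    induction x using TensorProduct.induction_on with
    | zero => simp
    | add x y hx hy => rw [map_add, map_add, hx, hy, map_add]
    | tmul m v =>
      induction m using μ.induction_on with
      | zero => simp
      | add x y hx hy => rw [TensorProduct.add_tmul, map_add, map_add, hx, hy, map_add]
      | mem a u hu =>
        induction v using (partsFree (K := K) (n := n) p (F.deg i)).induction_on with
        | zero => simp
        | add x y hx hy => rw [TensorProduct.tmul_add, map_add, map_add, hx, hy, map_add]
        | mem g v hv =>
          rw [(τ i).proj_of_mem (hτ i) k (a + g.1, g.2) _
            (Submodule.subset_span ⟨a, g.1, rfl, u, hu, v, hv, rfl⟩)]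
          have h : j i (r i (u ⊗ₜ v)) = u ⊗ₜ[PolyX K n] (partsFree (K := K) (n := n) p
            (F.deg i)).proj (isGradedX_freeGrading (F.deg i)) k v := rfl
          rw [h, Parts.proj_of_mem _ _ k g v hv]
          split_ifs <;> simp
  have hdj : ∀ i x, F.tensorD M i (j (i + 1) x) = j i (F.tensorDComponent k M i x) := by
    intro i x
    induction x with
    | zero => simp
    | add x y hx hy => simp only [map_add, hx, hy]
    | tmul m v => rfl
  have hdr : ∀ i x, F.tensorDComponent k M i (r (i + 1) x) = r i (F.tensorD M i x) := by
    intro i x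
    have h : F.tensorD M i ((τ (i + 1)).proj (hτ (i + 1)) k x) =
        (τ i).proj (hτ i) k (F.tensorD M i x) :=
      (τ (i + 1)).map_proj (hτ (i + 1)) k (τ i) (hτ i) (F.tensorD M i).toAddMonoidHom
        (F.tensorD_mem i) x
    -- Formally from `r j = 1`, `j r = proj`, and the fact that `j` and the projections commute with
    -- the differentials.
    rw [← hrj i (F.tensorDComponent k M i _), ← hdj, hjr, h, ← hjr, hrj]
  refine exists_equiv_component_subquotient (τ i) (hτ i) k (F.cycles M i) (F.boundaries M i) hZ hB
    _ _ (j i) (r i) (hrj i) (hjr i) ?_ ?_ ?_ ?_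
  · cases i with
    | zero => exact fun _ _ => trivial
    | succ i =>
      intro z hz
      have hz : F.tensorDComponent k M i z = 0 := hz
      change F.tensorD M i _ = 0
      rw [hdj, hz, map_zero]
  · rintro _ ⟨w, rfl⟩
    exact ⟨_, hdj i w⟩
  · cases i with
    | zero => exact fun _ _ => trivial
    | succ i =>
      intro z hz
      have hz : F.tensorD M i z = 0 := hz
      change F.tensorDComponent k M i _ = 0
      rw [hdr, hz, map_zero]
  · rintro _ ⟨w, rfl⟩
    exact ⟨_, hdr i w⟩

end BigradedFreeResolution

end Resolutions

/-! ### Finite generation of `N_k` and the stable dimension of `M ⊗ N_k` -/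

section Components

variable {K : Type*} [Field K] {n m : ℕ} {p : Fin m → ℕ}

theorem snd_weight (d : Fin n ⊕ Fin m →₀ ℕ) :
    (Finsupp.weight (Sum.elim (fun _ : Fin n => ((1 : ℤ), (0 : ℤ)))
      (fun j : Fin m => ((p j : ℤ), (1 : ℤ)))) d).2 = ∑ j, (d (Sum.inr j) : ℤ) := by
  rw [Finsupp.weight_apply, Finsupp.sum_fintype _ _ (by simp), Fintype.sum_sum_type, Prod.snd_add,
    Prod.snd_sum, Prod.snd_sum]
  simp

/-- A monomial of positive degree in the `y_j` is divisible by one of them. -/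
theorem mem_iSup_smul_component (l : ℕ) :
    component n (gradingXY K n p) (l + 1 : ℤ) ≤ ⨆ j : Fin m, (component n (gradingXY K n p) l).map
      ((LinearMap.mulLeft (PolyXY K n m)
        (MvPolynomial.X (Sum.inr j) : PolyXY K n m)).restrictScalars
        (PolyX K n)) := by
  classical
  refine Submodule.span_le.2 fun f hf => ?_
  obtain ⟨c, hc⟩ := Set.mem_iUnion.1 hf
  have hc : f ∈ gradingXY K n p (c, l + 1) := hc
  rw [f.as_sum]
  refine sum_mem fun d hd => ?_
  have hw := hc (MvPolynomial.mem_support_iff.1 hd)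
  have h2 := snd_weight (p := p) d
  rw [hw] at h2
  have : ∃ j, d (Sum.inr j) ≠ 0 := by
    by_contra! h0
    simp only [h0] at h2
    simp at h2
    omega
  obtain ⟨j, hj⟩ := this
  have hd' : Finsupp.single (Sum.inr j) 1 + (d - Finsupp.single (Sum.inr j) 1) = d :=
    add_tsub_cancel_of_le (by simpa [Nat.one_le_iff_ne_zero] using hj)
  refine Submodule.mem_iSup_of_mem j ⟨MvPolynomial.monomial (d - Finsupp.single (Sum.inr j) 1)
    (f.coeff d), Submodule.subset_span (Set.mem_iUnion.2 ⟨c - p j, ?_⟩), ?_⟩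
  · refine MvPolynomial.isWeightedHomogeneous_monomial _ _ _ ?_
    have h3 := congrArg (Finsupp.weight (Sum.elim (fun _ : Fin n => ((1 : ℤ), (0 : ℤ)))
      (fun j : Fin m => ((p j : ℤ), (1 : ℤ))))) hd'
    rw [map_add, Finsupp.weight_single, hw] at h3
    simp only [Sum.elim_inr, one_smul] at h3
    rw [← eq_sub_iff_add_eq'] at h3
    rw [h3]
    ext <;> simp
  · change MvPolynomial.X (Sum.inr j) * MvPolynomial.monomial _ _ = _
    rw [MvPolynomial.X, MvPolynomial.monomial_mul, one_mul, hd']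

theorem component_gradingXY_zero :
    component n (gradingXY K n p) 0 ≤
      LinearMap.range (Algebra.linearMap (PolyX K n) (PolyXY K n m)) := by
  refine Submodule.span_le.2 fun f hf => ?_
  obtain ⟨c, hc⟩ := Set.mem_iUnion.1 hf
  have hc : f ∈ gradingXY K n p (c, 0) := hc
  rw [f.as_sum]
  refine sum_mem fun d hd => ?_
  have hw := hc (MvPolynomial.mem_support_iff.1 hd)
  have h2 := snd_weight (p := p) d
  rw [hw, eq_comm, Finset.sum_eq_zero_iff_of_nonneg (fun _ _ => by positivity)] at h2
  refine ⟨MvPolynomial.monomial (Finsupp.sumFinsuppEquivProdFinsupp d).1 (f.coeff d), ?_⟩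
  change MvPolynomial.rename Sum.inl _ = _
  rw [MvPolynomial.rename_monomial]
  refine congrArg (fun e => MvPolynomial.monomial e (f.coeff d)) (Finsupp.ext ?_)
  rintro (i | j)
  · rw [Finsupp.mapDomain_apply Sum.inl_injective]
    rfl
  · rw [Finsupp.mapDomain_of_notMem_range _ _ (by simp)]
    exact_mod_cast (h2 j (Finset.mem_univ j)).symm

theorem component_gradingXY_of_neg {l : ℤ} (hl : l < 0) : component n (gradingXY K n p) l = ⊥ := by
  refine eq_bot_iff.2 (Submodule.span_le.2 fun f hf => ?_)
  obtain ⟨c, hc⟩ := Set.mem_iUnion.1 hf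
  have hc : f ∈ gradingXY K n p (c, l) := hc
  change f = 0
  rw [f.as_sum]
  refine Finset.sum_eq_zero fun d hd => ?_
  have hw := hc (MvPolynomial.mem_support_iff.1 hd)
  have h2 := snd_weight (p := p) d
  rw [hw] at h2
  have : (0 : ℤ) ≤ ∑ j, (d (Sum.inr j) : ℤ) := by positivity
  simp only at h2
  omega

/-- Induction on the degree in `y`, from `A_0 = S`: the component `A_{l+1}` lies in the sum of the
`y_j A_l`, and `S` is noetherian. -/
theorem fg_component_gradingXY (l : ℤ) : (component n (gradingXY K n p) l).FG := by
  rcases lt_or_ge l 0 with hl | hl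
  · rw [component_gradingXY_of_neg hl]
    exact Submodule.fg_bot
  · lift l to ℕ using hl
    induction l with
    | zero => exact (Submodule.fg_range _).of_le component_gradingXY_zero
    | succ l ih =>
      rw [Nat.cast_succ]
      exact (Submodule.fg_iSup _ fun j => ih.map _).of_le (mem_iSup_smul_component l)

variable {N : Type*} [AddCommGroup N] [Module K N] [Module (PolyX K n) N] [Module (PolyXY K n m) N]
  [IsScalarTower (PolyX K n) (PolyXY K n m) N] {𝒩 : ℤ × ℤ → Submodule K N}

/-- The map `A_(k - δ_b) → N_k` that belongs to the basis element with index `b`. -/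
def basisMap {r : ℕ} (φ : (Fin r →₀ PolyXY K n m) →ₗ[PolyXY K n m] N) (b : Fin r) :
    PolyXY K n m →ₗ[PolyX K n] N :=
  (φ.comp (Finsupp.lsingle b)).restrictScalars (PolyX K n)

theorem basisMap_mem {r : ℕ} {δ : Fin r → ℤ × ℤ} (φ : (Fin r →₀ PolyXY K n m) →ₗ[PolyXY K n m] N)
    (hφ : ∀ g f, f ∈ freeGrading p δ g → φ f ∈ 𝒩 g) (b : Fin r) (k : ℤ) (a : PolyXY K n m)
    (ha : a ∈ component n (gradingXY K n p) k) :
    basisMap φ b a ∈ component n 𝒩 (k + (δ b).2) := by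
  have : component n (gradingXY K n p) k ≤ (component n 𝒩 (k + (δ b).2)).comap (basisMap φ b) := by
    refine Submodule.span_le.2 fun a ha => ?_
    obtain ⟨c, hc⟩ := Set.mem_iUnion.1 ha
    exact Submodule.subset_span (Set.mem_iUnion.2 ⟨c + (δ b).1,
      hφ _ _ (single_mem_freeGrading p δ b (c, k) a hc)⟩)
  exact this ha

/-- Projecting a preimage to second degree `k` shows that `(⨁ A(-δ b))_k` already covers `N_k`. -/
theorem component_le_iSup {r : ℕ} {δ : Fin r → ℤ × ℤ}
    (φ : (Fin r →₀ PolyXY K n m) →ₗ[PolyXY K n m] N) (hφs : Function.Surjective φ)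
    (hφ : ∀ g f, f ∈ freeGrading p δ g → φ f ∈ 𝒩 g) (ν : Parts 𝒩) (h𝒩 : IsGradedX (n := n) 𝒩)
    (k : ℤ) : component n 𝒩 k ≤
      ⨆ b, (component n (gradingXY K n p) (k - (δ b).2)).map (basisMap φ b) := by
  intro x hx
  obtain ⟨f, rfl⟩ := hφs x
  let σ := partsFree (K := K) (n := n) p δ
  have hσ := isGradedX_freeGrading (K := K) (n := n) (p := p) δ
  have h1 : φ (σ.proj hσ k f) = φ f :=
    (σ.map_proj hσ k ν h𝒩 φ.toAddMonoidHom hφ f).trans (ν.proj_of_mem_component h𝒩 k hx)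
  rw [← h1]
  have key : component n (freeGrading p δ) k ≤ (⨆ b, (component n (gradingXY K n p)
      (k - (δ b).2)).map (basisMap φ b)).comap (φ.restrictScalars (PolyX K n)) := by
    refine Submodule.span_le.2 fun f hf => ?_
    obtain ⟨c, hc⟩ := Set.mem_iUnion.1 hf
    change φ f ∈ (⨆ b, (component n (gradingXY K n p) (k - (δ b).2)).map (basisMap φ b) :
      Submodule (PolyX K n) N)
    rw [← Finsupp.univ_sum_single f, map_sum]
    refine sum_mem fun b _ => Submodule.mem_iSup_of_mem b
      ⟨f b, Submodule.subset_span (Set.mem_iUnion.2 ⟨c - (δ b).1, hc b⟩), rfl⟩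
  exact key (σ.proj_mem_component hσ k f)

variable (K n N) in
/-- Multiplication by `y_j`. -/
def mulY (j : Fin m) : N →ₗ[PolyX K n] N :=
  (LinearMap.lsmul (PolyXY K n m) N (MvPolynomial.X (Sum.inr j))).restrictScalars (PolyX K n)

theorem mulY_mem [SetLike.GradedSMul (gradingXY K n p) 𝒩] (j : Fin m) (k : ℤ) (x : N)
    (hx : x ∈ component n 𝒩 k) : mulY K n N j x ∈ component n 𝒩 (k + 1) := by
  have : component n 𝒩 k ≤ (component n 𝒩 (k + 1)).comap (mulY K n N j) := by
    refine Submodule.span_le.2 fun x hx => ?_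
    obtain ⟨c, hc⟩ := Set.mem_iUnion.1 hx
    have hX : (MvPolynomial.X (Sum.inr j) : PolyXY K n m) ∈ gradingXY K n p (p j, 1) :=
      MvPolynomial.isWeightedHomogeneous_X _ _ _
    have := SetLike.GradedSMul.smul_mem hX hc
    refine Submodule.subset_span (Set.mem_iUnion.2 ⟨p j + c, ?_⟩)
    rwa [vadd_eq_add, Prod.mk_add_mk, add_comm 1 k] at this
  exact this hx

/-- The components of a finitely generated bigraded module are finitely generated over `K[x]`, and
almost all of them generate the next one. -/
theorem exists_generates_component [IsScalarTower K (PolyXY K n m) N]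
    [Module.Finite (PolyXY K n m) N] (𝒩 : ℤ × ℤ → Submodule K N)
    [DirectSum.Decomposition 𝒩] [SetLike.GradedSMul (gradingXY K n p) 𝒩] :
    (∀ k, Module.Finite (PolyX K n) (component n 𝒩 k)) ∧
      ∃ k₀ : ℤ, ∀ k ≥ k₀,
        component n 𝒩 (k + 1) ≤ ⨆ j : Fin m, (component n 𝒩 k).map (mulY K n N j) := by
  have hN := isGrading_of_decomposition 𝒩
  let ν := Parts.ofDecomposition 𝒩
  have h𝒩 := isGradedX_of_gradedSMul (n := n) (p := p) 𝒩
  obtain ⟨r, δ, φ, h1, hφ⟩ := exists_cover (n := n) p 𝒩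
    (fun g h a x ha hx => SetLike.GradedSMul.smul_mem ha hx) ⊤ Module.Finite.fg_top
    (fun x _ => by
      obtain ⟨f, hf, h⟩ := hN.exists_sum x
      exact ⟨f, fun g => ⟨hf g, trivial⟩, h⟩)
  have hle := component_le_iSup φ (LinearMap.range_eq_top.1 h1) hφ ν h𝒩
  refine ⟨fun k => Module.Finite.iff_fg.2 (Submodule.FG.of_le
    (Submodule.fg_iSup _ fun b => (fg_component_gradingXY _).map _) (hle k)), ?_⟩
  -- Beyond the second degrees of all generators each `k - δ_b` is nonnegative, so every coefficient
  -- in degree `k + 1 - δ_b` is divisible, monomial by monomial, by some `y_j`.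
  obtain ⟨k₀, hk₀⟩ := (Set.finite_range fun b => (δ b).2).bddAbove
  refine ⟨k₀, fun k hk => (hle (k + 1)).trans (iSup_le fun b => ?_)⟩
  have hb : (δ b).2 ≤ k := (hk₀ ⟨b, rfl⟩).trans hk
  obtain ⟨l, hl⟩ := Int.eq_ofNat_of_zero_le (sub_nonneg.2 hb)
  have hl' : k + 1 - (δ b).2 = l + 1 := by omega
  rw [hl']
  refine (Submodule.map_mono (mem_iSup_smul_component l)).trans ?_
  rw [Submodule.map_iSup]
  refine iSup_mono fun j => ?_
  rintro _ ⟨_, ⟨a, ha, rfl⟩, rfl⟩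
  refine ⟨basisMap φ b a, ?_, ?_⟩
  · have := basisMap_mem φ hφ b l a ha
    rwa [← hl, sub_add_cancel] at this
  · change (MvPolynomial.X (Sum.inr j) : PolyXY K n m) • φ (Finsupp.single b a) =
      φ (Finsupp.single b (MvPolynomial.X (Sum.inr j) * a))
    rw [← map_smul, Finsupp.smul_single, smul_eq_mul]

/-- `M ⊗ N_{k+1}` is the sum of the images of `M ⊗ N_k` under the `S`-linear multiplications by the
`y_j`. -/
theorem annihilator_tensor_component_le [SetLike.GradedSMul (gradingXY K n p) 𝒩]
    {M : Type*} [AddCommGroup M] [Module (PolyX K n) M] (k : ℤ)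
    (h : component n 𝒩 (k + 1) ≤ ⨆ j : Fin m, (component n 𝒩 k).map (mulY K n N j)) :
    Module.annihilator (PolyX K n) (M ⊗[PolyX K n] component n 𝒩 k) ≤
      Module.annihilator (PolyX K n) (M ⊗[PolyX K n] component n 𝒩 (k + 1)) := by
  intro s hs
  rw [Module.mem_annihilator] at hs ⊢
  let μ : ∀ j, component n 𝒩 k →ₗ[PolyX K n] component n 𝒩 (k + 1) := fun j =>
    (mulY K n N j).restrict (mulY_mem (p := p) j k)
  have htop : ⨆ j, LinearMap.range (μ j) = ⊤ := by
    refine Submodule.map_injective_of_injective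
      (Submodule.subtype_injective (component n 𝒩 (k + 1))) ?_
    rw [Submodule.map_subtype_top, Submodule.map_iSup]
    refine le_antisymm (iSup_le fun j => ?_) (h.trans (iSup_mono fun j => ?_))
    · rintro _ ⟨x, -, rfl⟩
      exact x.2
    · rintro _ ⟨x, hx, rfl⟩
      exact ⟨μ j ⟨x, hx⟩, ⟨_, rfl⟩, rfl⟩
  intro z
  induction z with
  | zero => simp
  | add x y hx hy => rw [smul_add, hx, hy, add_zero]
  | tmul u w =>
    have hw : w ∈ ⨆ j, LinearMap.range (μ j) := htop ▸ trivial
    induction hw using Submodule.iSup_induction' with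
    | zero => simp
    | add x y _ _ hx hy => rw [TensorProduct.tmul_add, smul_add, hx, hy, add_zero]
    | mem j x hx =>
      obtain ⟨v, rfl⟩ := hx
      have := congrArg ((μ j).lTensor M) (hs (u ⊗ₜ v))
      rwa [map_smul, map_zero, LinearMap.lTensor_tmul] at this

/-- The dimension of `M ⊗ N_k` is constant for large `k`. -/
theorem exists_supportDim_tensor_component_eq [IsScalarTower K (PolyXY K n m) N]
    [Module.Finite (PolyXY K n m) N] (𝒩 : ℤ × ℤ → Submodule K N)
    [DirectSum.Decomposition 𝒩] [SetLike.GradedSMul (gradingXY K n p) 𝒩]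
    (M : Type*) [AddCommGroup M] [Module (PolyX K n) M] [Module.Finite (PolyX K n) M] :
    ∃ d, ∀ᶠ k : ℤ in Filter.atTop,
      Module.supportDim (PolyX K n) (M ⊗[PolyX K n] component n 𝒩 k) = d := by
  obtain ⟨hfin, k₀, hk₀⟩ := exists_generates_component (n := n) (p := p) 𝒩
  -- An ascending chain of ideals, hence stationary. The dimension of a finite module depends only
  -- on its annihilator.
  let I : ℕ →o Ideal (PolyX K n) :=
    { toFun := fun i => Module.annihilator (PolyX K n) (M ⊗[PolyX K n] component n 𝒩 (k₀ + i))
      monotone' := monotone_nat_of_le_succ fun i => by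
        have := annihilator_tensor_component_le (p := p) (M := M) (k₀ + i) (hk₀ _ (by omega))
        rwa [add_assoc, ← Nat.cast_succ] at this }
  obtain ⟨i₀, hi₀⟩ := monotone_stabilizes_iff_noetherian.2 (inferInstanceAs
    (IsNoetherian (PolyX K n) (PolyX K n))) I
  refine ⟨ringKrullDim (PolyX K n ⧸ I i₀), Filter.eventually_atTop.2 ⟨k₀ + i₀, fun k hk => ?_⟩⟩
  obtain ⟨i, hi⟩ := Int.eq_ofNat_of_zero_le (sub_nonneg.2 hk)
  rw [Module.supportDim_eq_ringKrullDim_quotient_annihilator, hi₀ (i₀ + i) (by omega)]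
  have : k = k₀ + ((i₀ + i : ℕ) : ℤ) := by push_cast; omega
  rw [this]
  rfl

end Components

/-! ### Homogeneous generators, and dimension counts in graded modules -/

section HomogeneousGenerators

/-- The products of degree `c` of monomials with elements of `T`. -/
def monomialProducts {K : Type*} [Field K] {n : ℕ} {V : Type*} [AddCommGroup V]
    [Module (PolyX K n) V] (T : Finset (ℤ × V)) (c : ℤ) : Set V :=
  {v | ∃ α : Fin n →₀ ℕ, ∃ t ∈ T, (α.degree : ℤ) + t.1 = c ∧
    v = (MvPolynomial.monomial α 1 : PolyX K n) • t.2}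

theorem finite_monomialProducts {K : Type*} [Field K] {n : ℕ} {V : Type*} [AddCommGroup V]
    [Module (PolyX K n) V] (T : Finset (ℤ × V)) (c : ℤ) :
    (monomialProducts (K := K) (n := n) T c).Finite := by
  refine ((Set.Finite.prod (Finsupp.finite_of_degree_le (σ := Fin n)
    (T.sup fun t => (c - t.1).toNat)) T.finite_toSet).image fun x =>
      (MvPolynomial.monomial x.1 1 : PolyX K n) • x.2.2).subset ?_
  rintro _ ⟨α, t, ht, h, rfl⟩
  refine ⟨(α, t), ⟨?_, ht⟩, rfl⟩
  have : (c - t.1).toNat ≤ T.sup fun t => (c - t.1).toNat :=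
    Finset.le_sup (f := fun t : ℤ × V => (c - t.1).toNat) ht
  change α.degree ≤ _
  omega

variable {K : Type*} [Field K] {n : ℕ}
  {V : Type*} [AddCommGroup V] [Module K V] [Module (PolyX K n) V]

variable (n) in
/-- Multiplication by a variable raises the degree by one. -/
def RaisesDegree (𝒱 : ℤ → Submodule K V) : Prop :=
  ∀ (i : Fin n) (c : ℤ), ∀ v ∈ 𝒱 c, (MvPolynomial.X i : PolyX K n) • v ∈ 𝒱 (c + 1)

variable {𝒱 : ℤ → Submodule K V}

theorem RaisesDegree.monomial_smul_mem (h : RaisesDegree n 𝒱) (α : Fin n →₀ ℕ) (c : ℤ) (v : V)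
    (hv : v ∈ 𝒱 c) : (MvPolynomial.monomial α 1 : PolyX K n) • v ∈ 𝒱 (α.degree + c) := by
  induction α using Finsupp.induction_linear generalizing c v with
  | zero => simpa [MvPolynomial.monomial_zero'] using hv
  | add α β hα hβ =>
    rw [← one_mul (1 : K), ← MvPolynomial.monomial_mul, mul_smul, map_add, Nat.cast_add, add_assoc]
    exact hα _ _ (hβ _ _ hv)
  | single i k =>
    rw [← MvPolynomial.X_pow_eq_monomial, Finsupp.degree_single]
    induction k with
    | zero => simpa using hv
    | succ k ih =>
      rw [pow_succ', mul_smul, Nat.cast_succ, add_right_comm]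
      exact h i _ _ ih

/-- If smaller graded pieces already span everything, uniqueness of homogeneous parts leaves no room
for them to be proper. -/
theorem Parts.mem_of_iSup_eq_top (ν : Parts 𝒱) (W : ℤ → Submodule K V) (hW : ∀ c, W c ≤ 𝒱 c)
    (htop : ⨆ c, W c = ⊤) (c : ℤ) : 𝒱 c ≤ W c := by
  classical
  have key : ∀ v : V, ∀ c, ν.parts v c ∈ W c := by
    intro v
    refine Submodule.iSup_induction W (motive := fun v => ∀ c, ν.parts v c ∈ W c)
      (show v ∈ ⨆ c, W c from htop ▸ trivial) (fun e v hv c => ?_) (by simp) ?_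
    · rw [ν.of_mem e v (hW e hv), Finsupp.single_apply]
      split_ifs with h
      · exact h ▸ hv
      · exact zero_mem _
    · intro x y hx hy c
      rw [map_add]
      exact add_mem (hx c) (hy c)
  intro v hv
  have := key v c
  rwa [ν.of_mem c v hv, Finsupp.single_eq_same] at this

theorem Parts.parts_X_smul (ν : Parts 𝒱) (h : RaisesDegree n 𝒱) (i : Fin n) (v : V) (c : ℤ) :
    ν.parts ((MvPolynomial.X i : PolyX K n) • v) (c + 1) =
      (MvPolynomial.X i : PolyX K n) • ν.parts v c := by
  classical
  induction v using ν.induction_on with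
  | zero => simp
  | add x y hx hy => simp only [smul_add, map_add, Finsupp.add_apply, hx, hy]
  | mem g v hv =>
    rw [ν.of_mem g v hv, ν.of_mem (g + 1) _ (h i g v hv), Finsupp.single_apply,
      Finsupp.single_apply]
    simp only [add_left_inj]
    split_ifs <;> simp

theorem parts_X_smul_mem (ν : Parts 𝒱) (h : RaisesDegree n 𝒱) (i : Fin n) (z : V)
    (hz : z ∈ ((MvPolynomial.X i : PolyX K n) • ⊤ : Submodule (PolyX K n) V)) (g : ℤ) :
    ν.parts z g ∈ ((MvPolynomial.X i : PolyX K n) • ⊤ : Submodule (PolyX K n) V) := by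
  obtain ⟨w, -, rfl⟩ := (Submodule.mem_smul_pointwise_iff_exists _ _ _).1 hz
  have := ν.parts_X_smul h i w (g - 1)
  rw [sub_add_cancel] at this
  rw [this]
  exact Submodule.smul_mem_pointwise_smul _ _ _ trivial

variable [IsScalarTower K (PolyX K n) V]

/-- `T` consists of the homogeneous parts of a finite generating set, labelled by degree. In each
degree only finitely many monomial products occur, whence finite-dimensionality and the vanishing in
low degrees. -/
theorem exists_homogeneous_generators [Module.Finite (PolyX K n) V] (ν : Parts 𝒱)
    (h : RaisesDegree n 𝒱) : ∃ T : Finset (ℤ × V), ∀ c,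
      𝒱 c ≤ Submodule.span K (monomialProducts (K := K) (n := n) T c) := by
  classical
  obtain ⟨s, hs⟩ := Module.Finite.fg_top (R := PolyX K n) (M := V)
  let T : Finset (ℤ × V) :=
    s.biUnion fun x => (ν.parts x).support.image fun c => (c, ν.parts x c)
  have hT : ∀ t ∈ T, t.2 ∈ 𝒱 t.1 := by
    intro t ht
    simp only [T, Finset.mem_biUnion, Finset.mem_image] at ht
    obtain ⟨x, _, c, _, rfl⟩ := ht
    exact ν.mem x c
  refine ⟨T, ν.mem_of_iSup_eq_top _ (fun c => Submodule.span_le.2 ?_) (eq_top_iff.2 ?_)⟩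
  · rintro _ ⟨α, t, ht, rfl, rfl⟩
    exact h.monomial_smul_mem α _ _ (hT t ht)
  · rintro v -
    have h1 : ∀ (f : PolyX K n), ∀ t ∈ T, f • t.2 ∈
        ⨆ c, Submodule.span K (monomialProducts (K := K) (n := n) T c) := by
      intro f t ht
      rw [f.as_sum, Finset.sum_smul]
      refine sum_mem fun α _ => ?_
      have : (MvPolynomial.monomial α (f.coeff α) : PolyX K n) =
          f.coeff α • MvPolynomial.monomial α 1 := by
        rw [MvPolynomial.smul_monomial, smul_eq_mul, mul_one]
      rw [this, smul_assoc]
      exact Submodule.smul_mem _ _ (Submodule.mem_iSup_of_mem _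
        (Submodule.subset_span ⟨α, t, ht, rfl, rfl⟩))
    have hv : v ∈ Submodule.span (PolyX K n) (s : Set V) := hs ▸ trivial
    suffices H : ∀ f : PolyX K n, f • v ∈
        ⨆ c, Submodule.span K (monomialProducts (K := K) (n := n) T c) by simpa using H 1
    induction hv using Submodule.span_induction with
    | zero => simp
    | add x y _ _ hx hy =>
      intro f
      rw [smul_add]
      exact add_mem (hx f) (hy f)
    | smul a x _ hx =>
      intro f
      rw [smul_smul]
      exact hx _
    | mem x hx =>
      intro f
      rw [← ν.sum_parts x, Finsupp.sum, Finset.smul_sum]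
      exact sum_mem fun c hc => h1 f (c, ν.parts x c)
        (Finset.mem_biUnion.2 ⟨x, hx, Finset.mem_image_of_mem _ hc⟩)

theorem finiteDimensional_of_graded [Module.Finite (PolyX K n) V] (ν : Parts 𝒱)
    (h : RaisesDegree n 𝒱) (c : ℤ) : FiniteDimensional K (𝒱 c) := by
  obtain ⟨T, hT⟩ := exists_homogeneous_generators ν h
  have := FiniteDimensional.span_of_finite K (finite_monomialProducts (K := K) (n := n) T c)
  exact Submodule.finiteDimensional_of_le (hT c)

theorem exists_eq_bot_of_lt [Module.Finite (PolyX K n) V] (ν : Parts 𝒱) (h : RaisesDegree n 𝒱) :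
    ∃ c₀, ∀ c < c₀, 𝒱 c = ⊥ := by
  obtain ⟨T, hT⟩ := exists_homogeneous_generators ν h
  obtain ⟨c₀, hc₀⟩ := (T.finite_toSet.image Prod.fst).bddBelow
  refine ⟨c₀, fun c hc => eq_bot_iff.2 ((hT c).trans (Submodule.span_le.2 ?_))⟩
  rintro _ ⟨α, t, ht, h, rfl⟩
  have := hc₀ ⟨t, ht, rfl⟩
  omega

/-- A monomial of degree above `∑ N_i` has an exponent above some `N_i`, so it acts as zero. -/
theorem exists_eq_bot_of_gt [Module.Finite (PolyX K n) V] (ν : Parts 𝒱) (h : RaisesDegree n 𝒱)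
    (hnil : ∀ i : Fin n, ∃ N : ℕ, ∀ v : V, (MvPolynomial.X i ^ N : PolyX K n) • v = 0) :
    ∃ c₀, ∀ c > c₀, 𝒱 c = ⊥ := by
  obtain ⟨T, hT⟩ := exists_homogeneous_generators ν h
  obtain ⟨c₀, hc₀⟩ := (T.finite_toSet.image Prod.fst).bddAbove
  choose N hN using hnil
  refine ⟨c₀ + ((∑ i, N i : ℕ) : ℤ), fun c hc =>
    eq_bot_iff.2 ((hT c).trans (Submodule.span_le.2 ?_))⟩
  rintro _ ⟨α, t, ht, h, rfl⟩
  have h1 := hc₀ ⟨t, ht, rfl⟩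
  have h2 : ∑ i, N i < α.degree := by omega
  rw [Finsupp.degree_eq_sum] at h2
  obtain ⟨i, -, hi⟩ := Finset.exists_lt_of_sum_lt h2
  have h3 : (MvPolynomial.monomial α 1 : PolyX K n) =
      MvPolynomial.monomial (α - Finsupp.single i (N i)) 1 * MvPolynomial.X i ^ N i := by
    rw [MvPolynomial.X_pow_eq_monomial, MvPolynomial.monomial_mul, one_mul, tsub_add_cancel_of_le]
    simpa using hi.le
  change _ • t.2 = 0
  rw [h3, mul_smul, hN, smul_zero]

theorem RaisesDegree.submodule (h : RaisesDegree n 𝒱) (Z : Submodule (PolyX K n) V) :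
    RaisesDegree n (fun g => (𝒱 g).comap (Z.subtype.restrictScalars K)) :=
  fun i c v hv => h i c v hv

theorem RaisesDegree.quotient (h : RaisesDegree n 𝒱) (B : Submodule (PolyX K n) V) :
    RaisesDegree n (fun g => (𝒱 g).map (B.mkQ.restrictScalars K)) := by
  rintro i c _ ⟨v, hv, rfl⟩
  exact ⟨_, h i c v hv, rfl⟩

theorem finrank_add_finrank_quotient (B : Submodule (PolyX K n) V) (c : ℤ)
    [FiniteDimensional K (𝒱 c)] :
    Module.finrank K ((𝒱 c).comap (B.subtype.restrictScalars K)) +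
      Module.finrank K ((𝒱 c).map (B.mkQ.restrictScalars K)) = Module.finrank K (𝒱 c) := by
  rw [← LinearMap.range_domRestrict, ← LinearMap.finrank_range_add_finrank_ker
    ((B.mkQ.restrictScalars K).domRestrict (𝒱 c)), add_comm]
  congr 1
  refine LinearEquiv.finrank_eq
    { toFun := fun x => ⟨⟨x.1.1, x.2⟩, (Submodule.Quotient.mk_eq_zero B).2 x.1.2⟩
      invFun := fun x => ⟨⟨x.1.1, (Submodule.Quotient.mk_eq_zero B).1 x.2⟩, x.1.2⟩
      map_add' := fun _ _ => rfl
      map_smul' := fun _ _ => rfl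
      left_inv := fun _ => rfl
      right_inv := fun _ => rfl }

/-- The part of `x_i V` of degree `c + 1` is `x_i V_c`, which regularity identifies with `V_c`. -/
theorem finrank_quotSMulTop (ν : Parts 𝒱) (h : RaisesDegree n 𝒱) (i : Fin n)
    (hreg : IsSMulRegular V (MvPolynomial.X i : PolyX K n)) (c : ℤ)
    [FiniteDimensional K (𝒱 (c + 1))] :
    Module.finrank K (𝒱 c) + Module.finrank K ((𝒱 (c + 1)).map (Submodule.mkQ
      ((MvPolynomial.X i : PolyX K n) • ⊤ : Submodule (PolyX K n) V) |>.restrictScalars K)) =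
      Module.finrank K (𝒱 (c + 1)) := by
  rw [← finrank_add_finrank_quotient
    ((MvPolynomial.X i : PolyX K n) • ⊤ : Submodule (PolyX K n) V) (c + 1)]
  congr 1
  let f : 𝒱 c →ₗ[K] (𝒱 (c + 1)).comap (((MvPolynomial.X i : PolyX K n) • ⊤ :
      Submodule (PolyX K n) V).subtype.restrictScalars K) :=
    { toFun := fun v => ⟨⟨(MvPolynomial.X i : PolyX K n) • v.1,
        Submodule.smul_mem_pointwise_smul _ _ _ trivial⟩, h i c v v.2⟩
      map_add' := fun x y => Subtype.ext (Subtype.ext (smul_add _ _ _))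
      map_smul' := fun a x => Subtype.ext (Subtype.ext (smul_comm _ a x.1)) }
  refine (LinearEquiv.ofBijective f ⟨fun x y hxy => ?_, ?_⟩).finrank_eq
  · exact Subtype.ext (hreg (congrArg (fun z => z.1.1) hxy))
  · rintro ⟨⟨z, hz⟩, hzc⟩
    have hzc : z ∈ 𝒱 (c + 1) := hzc
    obtain ⟨w, -, rfl⟩ := (Submodule.mem_smul_pointwise_iff_exists _ _ _).1 hz
    refine ⟨⟨ν.parts w c, ν.mem w c⟩, Subtype.ext (Subtype.ext ?_)⟩
    change (MvPolynomial.X i : PolyX K n) • ν.parts w c = (MvPolynomial.X i : PolyX K n) • w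
    rw [← ν.parts_X_smul h i w c, ν.of_mem (c + 1) _ hzc, Finsupp.single_eq_same]

end HomogeneousGenerators

/-! ### Summation of eventually polynomial functions -/

section Summation

open Polynomial in
-- Bernoulli polynomials satisfy `B_{k+1}(x + 1) - B_{k+1}(x) = (k + 1) x^k`, so they provide the
-- antidifferences of the powers.
theorem exists_polynomial_sub_eq (R : ℚ[X]) {D : ℕ} (hR : R.degree < D) :
    ∃ Q : ℚ[X], Q.degree < (D + 1 : ℕ) ∧ ∀ x, Q.eval (x + 1) - Q.eval x = R.eval x := by
  have hdeg : ∀ k, (Polynomial.bernoulli k).degree ≤ k := by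
    intro k
    rw [bernoulli_def]
    refine (degree_sum_le _ _).trans (Finset.sup_le fun i hi => (degree_monomial_le _ _).trans ?_)
    exact Nat.cast_le.2 (Nat.lt_succ_iff.1 (Finset.mem_range.1 hi))
  have hsum : ∀ x, R.eval x = ∑ k ∈ Finset.range D, R.coeff k * x ^ k := by
    intro x
    rcases eq_or_ne R 0 with rfl | h0
    · simp
    · exact eval_eq_sum_range' ((natDegree_lt_iff_degree_lt h0).2 hR) x
  refine ⟨∑ k ∈ Finset.range D, C (R.coeff k / (k + 1)) * Polynomial.bernoulli (k + 1), ?_,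
    fun x => ?_⟩
  · refine (degree_sum_le _ _).trans_lt
      ((Finset.sup_lt_iff (WithBot.bot_lt_coe _)).2 fun k hk => ?_)
    refine (degree_mul_le _ _).trans_lt
      ((add_le_add degree_C_le (hdeg (k + 1))).trans_lt ?_)
    rw [zero_add]
    have := Finset.mem_range.1 hk
    exact_mod_cast Nat.succ_lt_succ this
  · rw [eval_finsetSum, eval_finsetSum, ← Finset.sum_sub_distrib, hsum]
    refine Finset.sum_congr rfl fun k _ => ?_
    simp only [eval_mul, eval_C]
    rw [add_comm x 1, bernoulli_eval_one_add, Nat.add_sub_cancel]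
    push_cast
    field_simp
    ring

open Polynomial in
theorem exists_eventually_eq_eval {f g : ℤ → ℕ} {R : ℚ[X]} {D : ℕ} (hR : R.degree < D)
    (hg : ∀ᶠ t : ℤ in Filter.atTop, (g t : ℚ) = R.eval (t : ℚ))
    (hf : ∀ t, f t + g (t + 1) = f (t + 1)) :
    ∃ P : ℚ[X], P.degree < (D + 1 : ℕ) ∧
      ∀ᶠ t : ℤ in Filter.atTop, (f t : ℚ) = P.eval (t : ℚ) := by
  -- The difference `f(t + 1) - f(t)` is `g(t + 1)`, so `R` has to be shifted by one.
  obtain ⟨Q, hQ, hQR⟩ := exists_polynomial_sub_eq (taylor 1 R) (D := D) (by rwa [degree_taylor])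
  obtain ⟨t₀, ht₀⟩ := Filter.eventually_atTop.1 hg
  refine ⟨Q + C (f t₀ - Q.eval (t₀ : ℚ)), ?_, Filter.eventually_atTop.2 ⟨t₀, fun t ht => ?_⟩⟩
  · refine (degree_add_le _ _).trans_lt (max_lt hQ (degree_C_le.trans_lt ?_))
    exact_mod_cast Nat.succ_pos D
  · induction t, ht using Int.leInduction with
    | base => simp
    | succ t ht ih =>
      have h1 := hQR t
      rw [taylor_eval] at h1
      have h2 := ht₀ (t + 1) (by omega)
      rw [← hf t]
      push_cast at h2 ⊢
      rw [ih, h2, ← h1]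
      simp only [eval_add, eval_C]
      ring

end Summation

/-! ### Hilbert polynomials and their degrees -/

section HilbertPolynomial

universe u

variable {K : Type*} [Field K] {n : ℕ}

theorem Parts.parts_X_pow_smul {V : Type*} [AddCommGroup V] [Module K V] [Module (PolyX K n) V]
    {𝒱 : ℤ → Submodule K V} (ν : Parts 𝒱) (h : RaisesDegree n 𝒱) (i : Fin n) (N : ℕ) (v : V)
    (c : ℤ) :
    ν.parts ((MvPolynomial.X i ^ N : PolyX K n) • v) (c + N) =
      (MvPolynomial.X i ^ N : PolyX K n) • ν.parts v c := by
  induction N with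
  | zero => simp
  | succ N ih =>
    rw [pow_succ', mul_smul, mul_smul, ← ih, ← ν.parts_X_smul h, Nat.cast_succ, add_assoc]

theorem Parts.parts_mem_torsionBy_X_pow {V : Type*} [AddCommGroup V] [Module K V]
    [Module (PolyX K n) V] {𝒱 : ℤ → Submodule K V} (ν : Parts 𝒱) (h : RaisesDegree n 𝒱) (i : Fin n)
    (N : ℕ) (z : V) (hz : z ∈ Submodule.torsionBy (PolyX K n) V (MvPolynomial.X i ^ N)) (c : ℤ) :
    ν.parts z c ∈ Submodule.torsionBy (PolyX K n) V (MvPolynomial.X i ^ N) := by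
  rw [Submodule.mem_torsionBy_iff] at hz ⊢
  rw [← ν.parts_X_pow_smul h, hz, map_zero, Finsupp.zero_apply]

/-- The submodules killed by powers of `x` become stationary; at that point, dividing out leaves no
`x`-torsion. -/
theorem exists_isSMulRegular_quotient_torsionBy {R : Type*} [CommRing R] [IsNoetherianRing R]
    (V : Type*) [AddCommGroup V] [Module R V] [Module.Finite R V] (x : R) :
    ∃ N : ℕ, IsSMulRegular (V ⧸ Submodule.torsionBy R V (x ^ N)) x := by
  have hmono : Monotone fun N : ℕ => Submodule.torsionBy R V (x ^ N) := fun a b hab =>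
    Submodule.torsionBy_le_torsionBy_of_dvd _ _ (pow_dvd_pow x hab)
  obtain ⟨N, hN⟩ := monotone_stabilizes_iff_noetherian.2 (inferInstance : IsNoetherian R V)
    ⟨_, hmono⟩
  refine ⟨N, IsSMulRegular.of_right_eq_zero_of_smul fun v hv => ?_⟩
  induction v using Submodule.Quotient.induction_on with
  | _ v =>
    rw [← Submodule.Quotient.mk_smul, Submodule.Quotient.mk_eq_zero,
      Submodule.mem_torsionBy_iff, smul_smul, ← pow_succ] at hv
    rw [Submodule.Quotient.mk_eq_zero]
    have := hN (N + 1) (Nat.le_succ N)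
    change Submodule.torsionBy R V (x ^ N) = Submodule.torsionBy R V (x ^ (N + 1)) at this
    rw [this]
    exact hv

open Polynomial in
/-- The Hilbert function is eventually given by a polynomial of degree less than `D`. -/
def HasHilbertPolynomial {V : Type*} [AddCommGroup V] [Module K V] (𝒱 : ℤ → Submodule K V)
    (D : ℕ) : Prop :=
  ∃ P : ℚ[X], P.degree < D ∧
    ∀ᶠ t : ℤ in Filter.atTop, (Module.finrank K (𝒱 t) : ℚ) = P.eval (t : ℚ)

theorem HasHilbertPolynomial.of_submodule_of_quotient {V : Type*} [AddCommGroup V] [Module K V]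
    [Module (PolyX K n) V] [IsScalarTower K (PolyX K n) V]
    {𝒱 : ℤ → Submodule K V} [∀ c, FiniteDimensional K (𝒱 c)] {D : ℕ} (B : Submodule (PolyX K n) V)
    (h1 : HasHilbertPolynomial (fun c => (𝒱 c).comap (B.subtype.restrictScalars K)) D)
    (h2 : HasHilbertPolynomial (fun c => (𝒱 c).map (B.mkQ.restrictScalars K)) D) :
    HasHilbertPolynomial 𝒱 D := by
  obtain ⟨P, hP, hPe⟩ := h1
  obtain ⟨Q, hQ, hQe⟩ := h2
  refine ⟨P + Q, (Polynomial.degree_add_le _ _).trans_lt (max_lt hP hQ), ?_⟩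
  filter_upwards [hPe, hQe] with t h1 h2
  rw [← finrank_add_finrank_quotient B t, Nat.cast_add, h1, h2, Polynomial.eval_add]

/-- A regular variable lowers the dimension by at least one, and the first difference of the Hilbert
function of `V` is the Hilbert function of `V / x_i V`, so summation applies. -/
theorem hasHilbertPolynomial_of_isSMulRegular {V : Type*} [AddCommGroup V] [Module K V]
    [Module (PolyX K n) V] [IsScalarTower K (PolyX K n) V] [Module.Finite (PolyX K n) V]
    {𝒱 : ℤ → Submodule K V} (ν : Parts 𝒱) (h : RaisesDegree n 𝒱) (i : Fin n)
    (hreg : IsSMulRegular V (MvPolynomial.X i : PolyX K n)) (D : ℕ)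
    (hD : Module.supportDim (PolyX K n) V ≤ (D : ℕ∞))
    (hQ : ∀ D' < D,
      Module.supportDim (PolyX K n) (QuotSMulTop (MvPolynomial.X i : PolyX K n) V) ≤ (D' : ℕ∞) →
      HasHilbertPolynomial (fun c => (𝒱 c).map (Submodule.mkQ
        ((MvPolynomial.X i : PolyX K n) • ⊤ : Submodule (PolyX K n) V) |>.restrictScalars K)) D') :
    HasHilbertPolynomial 𝒱 D := by
  have := finiteDimensional_of_graded ν h
  have hdim := (Module.supportDim_quotSMulTop_succ_le_of_notMem_minimalPrimes
    fun _ => hreg.notMem_of_mem_minimalPrimes).trans hD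
  have hf := fun c => finrank_quotSMulTop ν h i hreg c
  cases D with
  | zero =>
    -- In dimension at most 0 the quotient has dimension `⊥`, so it vanishes. The Hilbert function
    -- is then constant, and it is 0 in low degrees.
    have hbot : Module.supportDim (PolyX K n)
        (QuotSMulTop (MvPolynomial.X i : PolyX K n) V) = ⊥ := by
      generalize Module.supportDim (PolyX K n)
        (QuotSMulTop (MvPolynomial.X i : PolyX K n) V) = e at hdim
      induction e with
      | bot => rfl
      | coe e =>
        have : e + 1 ≤ 0 := by exact_mod_cast hdim
        simp at this
    have hsub := (Module.supportDim_eq_bot_iff_subsingleton (PolyX K n) _).1 hbot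
    obtain ⟨c₀, hc₀⟩ := exists_eq_bot_of_lt ν h
    have hconst : ∀ c, Module.finrank K (𝒱 (c + 1)) = Module.finrank K (𝒱 c) := by
      intro c
      rw [← hf c, Nat.add_eq_left]
      exact Module.finrank_zero_of_subsingleton
    refine ⟨0, by simp, Filter.eventually_atTop.2 ⟨c₀ - 1, fun t ht => ?_⟩⟩
    have : Module.finrank K (𝒱 t) = 0 := by
      induction t, ht using Int.leInduction with
      | base => rw [hc₀ _ (by omega), finrank_bot]
      | succ t ht ih => rw [hconst, ih]
    simp [this]
  | succ D =>
    obtain ⟨R, hR, hRe⟩ := hQ D (Nat.lt_succ_self D) (by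
      generalize Module.supportDim (PolyX K n)
        (QuotSMulTop (MvPolynomial.X i : PolyX K n) V) = e at hdim ⊢
      induction e with
      | bot => exact bot_le
      | coe e =>
        have h1 : e + 1 ≤ (D : ℕ∞) + 1 := by exact_mod_cast hdim
        exact_mod_cast (ENat.add_le_add_iff_right (by simp)).1 h1)
    exact exists_eventually_eq_eval hR hRe hf

/-- `J` contains the variables not yet known to act nilpotently. For `i ∈ J`, split `V` into its
`x_i`-power torsion, where `x_i` becomes nilpotent and `J` shrinks, and the quotient, where `x_i` is
regular and the dimension bound drops. For empty `J` only finitely many degrees survive. -/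
theorem hasHilbertPolynomial_of_nilpotent (D : ℕ)
    (ih : ∀ D' < D, ∀ {V : Type u} [AddCommGroup V] [Module K V] [Module (PolyX K n) V]
      [IsScalarTower K (PolyX K n) V] [Module.Finite (PolyX K n) V] {𝒱 : ℤ → Submodule K V},
      Parts 𝒱 → RaisesDegree n 𝒱 → Module.supportDim (PolyX K n) V ≤ (D' : ℕ∞) →
      HasHilbertPolynomial 𝒱 D')
    (J : Finset (Fin n)) {V : Type u} [AddCommGroup V] [Module K V]
    [Module (PolyX K n) V] [IsScalarTower K (PolyX K n) V] [Module.Finite (PolyX K n) V]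
    {𝒱 : ℤ → Submodule K V} (ν : Parts 𝒱) (h : RaisesDegree n 𝒱)
    (hD : Module.supportDim (PolyX K n) V ≤ (D : ℕ∞))
    (hJ : ∀ i ∉ J, ∃ N : ℕ, ∀ v : V, (MvPolynomial.X i ^ N : PolyX K n) • v = 0) :
    HasHilbertPolynomial 𝒱 D := by
  classical
  induction J using Finset.induction_on generalizing V with
  | empty =>
    obtain ⟨c₀, hc₀⟩ := exists_eq_bot_of_gt ν h fun i => hJ i (by simp)
    refine ⟨0, by simp, Filter.eventually_atTop.2 ⟨c₀ + 1, fun t ht => ?_⟩⟩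
    rw [hc₀ t (by omega), finrank_bot]
    simp
  | insert i J hi ihJ =>
    obtain ⟨N, hN⟩ := exists_isSMulRegular_quotient_torsionBy V (MvPolynomial.X i : PolyX K n)
    set B := Submodule.torsionBy (PolyX K n) V (MvPolynomial.X i ^ N) with hB
    have hparts : ∀ z ∈ B, ∀ c, ν.parts z c ∈ B := ν.parts_mem_torsionBy_X_pow h i N
    have := finiteDimensional_of_graded ν h
    refine HasHilbertPolynomial.of_submodule_of_quotient B ?_ ?_
    · refine ihJ (ν.submodule B hparts) (h.submodule B)
        ((Module.supportDim_le_of_injective B.subtype B.injective_subtype).trans hD) fun l hl => ?_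
      rcases eq_or_ne l i with rfl | hli
      · exact ⟨N, fun v => Subtype.ext v.2⟩
      · obtain ⟨N', hN'⟩ := hJ l (by simp [hli, hl])
        exact ⟨N', fun v => Subtype.ext (hN' v)⟩
    · have hD' := (Module.supportDim_le_of_surjective B.mkQ B.mkQ_surjective).trans hD
      refine hasHilbertPolynomial_of_isSMulRegular (ν.quotient B hparts) (h.quotient B) i hN D hD'
        fun D' hlt hQ => ih D' hlt
          ((ν.quotient B hparts).quotient _ (parts_X_smul_mem _ (h.quotient B) i))
          ((h.quotient B).quotient _) hQ

theorem hasHilbertPolynomial_of_supportDim_le (D : ℕ) {V : Type u} [AddCommGroup V] [Module K V]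
    [Module (PolyX K n) V] [IsScalarTower K (PolyX K n) V] [Module.Finite (PolyX K n) V]
    {𝒱 : ℤ → Submodule K V} (ν : Parts 𝒱) (h : RaisesDegree n 𝒱)
    (hD : Module.supportDim (PolyX K n) V ≤ (D : ℕ∞)) : HasHilbertPolynomial 𝒱 D := by
  induction D using Nat.strong_induction_on generalizing V with
  | _ D ih =>
    exact hasHilbertPolynomial_of_nilpotent D (fun D' hlt _ _ _ _ _ _ _ ν h hV => ih D' hlt ν h hV)
      Finset.univ ν h hD fun i hi => absurd (Finset.mem_univ i) hi

theorem iteratedHilbert_eq_zero {V : Type*} [AddCommGroup V] [Module K V]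
    {𝒱 : ℤ → Submodule K V} {c₀ : ℤ} (h : ∀ c < c₀, 𝒱 c = ⊥) (j : ℕ) (c : ℤ) (hc : c < c₀) :
    iteratedHilbert 𝒱 j c = 0 := by
  induction j generalizing c with
  | zero => rw [iteratedHilbert, h c hc, finrank_bot]
  | succ j ih =>
    rw [iteratedHilbert]
    exact finsum_mem_eq_zero_of_forall_eq_zero fun s hs => ih s (lt_of_le_of_lt hs hc)

/-- Vanishing in low degrees makes the `finsum` over `Set.Iic` a true finite sum; with infinite
support it would default to 0. -/
theorem iteratedHilbert_add {V : Type*} [AddCommGroup V] [Module K V]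
    {𝒱 : ℤ → Submodule K V} {c₀ : ℤ} (h : ∀ c < c₀, 𝒱 c = ⊥) (j : ℕ) (t : ℤ) :
    iteratedHilbert 𝒱 (j + 1) t + iteratedHilbert 𝒱 j (t + 1) =
      iteratedHilbert 𝒱 (j + 1) (t + 1) := by
  have hset : Set.Iic (t + 1) = insert (t + 1) (Set.Iic t) := by
    ext s
    simp only [Set.mem_Iic, Set.mem_insert_iff]
    omega
  have hfin : (Set.Iic t ∩ Function.support (iteratedHilbert 𝒱 j)).Finite := by
    refine (Set.finite_Icc c₀ t).subset fun s hs => ⟨?_, hs.1⟩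
    by_contra hlt
    exact hs.2 (iteratedHilbert_eq_zero h j s (not_le.1 hlt))
  rw [iteratedHilbert, iteratedHilbert, hset,
    finsum_mem_insert' _ (by simp) hfin, add_comm]

theorem exists_isIteratedHilbertPolynomial {V : Type u} [AddCommGroup V] [Module K V]
    [Module (PolyX K n) V] [IsScalarTower K (PolyX K n) V] [Module.Finite (PolyX K n) V]
    {𝒱 : ℤ → Submodule K V} (ν : Parts 𝒱) (h : RaisesDegree n 𝒱) {d : WithBot ℕ∞}
    (hd : Module.supportDim (PolyX K n) V ≤ d) (j : ℕ) :
    ∃ P : Polynomial ℚ, IsIteratedHilbertPolynomial 𝒱 j P ∧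
      P.degree.map (fun r : ℕ => (r : ℕ∞)) + 1 ≤ d + (j : WithBot ℕ∞) := by
  -- The zero module is separate: its polynomial is 0, of degree `⊥`, so the bound holds even for `d
  -- = ⊥`. Otherwise the dimension is a natural number, being at most `n`.
  rcases subsingleton_or_nontrivial V with hV | hV
  · refine ⟨0, Filter.Eventually.of_forall fun t => ?_, by simp⟩
    rw [iteratedHilbert_eq_zero (c₀ := t + 1) (fun c _ => Subsingleton.elim _ _) j t (by omega)]
    simp
  obtain ⟨D, hD⟩ : ∃ D : ℕ, Module.supportDim (PolyX K n) V = (D : ℕ∞) := by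
    have h1 := Module.supportDim_ne_bot_of_nontrivial (PolyX K n) V
    have h2 := (Module.supportDim_le_ringKrullDim (PolyX K n) V).trans_eq
      (MvPolynomial.ringKrullDim_of_isNoetherianRing)
    rw [ringKrullDim_eq_zero_of_field, zero_add, Nat.card_fin] at h2
    generalize Module.supportDim (PolyX K n) V = e at h1 h2
    induction e with
    | bot => exact absurd rfl h1
    | coe e =>
      have h3 : e ≤ (n : ℕ∞) := by exact_mod_cast h2
      obtain ⟨D, rfl⟩ := ENat.ne_top_iff_exists.1 (ne_top_of_le_ne_top (ENat.natCast_ne_top n) h3)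
      exact ⟨D, rfl⟩
  obtain ⟨c₀, hc₀⟩ := exists_eq_bot_of_lt ν h
  have key : ∃ P : Polynomial ℚ, P.degree < (D + j : ℕ) ∧ IsIteratedHilbertPolynomial 𝒱 j P := by
    induction j with
    | zero => exact hasHilbertPolynomial_of_supportDim_le D ν h hD.le
    | succ j ih =>
      obtain ⟨R, hR, hRe⟩ := ih
      exact exists_eventually_eq_eval hR hRe (iteratedHilbert_add hc₀ j)
  obtain ⟨P, hP, hPe⟩ := key
  refine ⟨P, hPe, le_trans ?_ (add_le_add_left (hD.symm.trans_le hd) _)⟩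
  induction hdeg : P.degree with
  | bot => simp
  | coe r =>
    have hr : r < D + j := by
      rw [hdeg] at hP
      exact WithBot.coe_lt_coe.1 hP
    rw [WithBot.map_coe]
    exact_mod_cast hr

end HilbertPolynomial

/-! ### Comparison lemmas and the conclusion -/

theorem supportDim_le_of_support_subset {R : Type*} [CommRing R] {V W : Type*} [AddCommGroup V]
    [Module R V] [AddCommGroup W] [Module R W] (h : Module.support R V ⊆ Module.support R W) :
    Module.supportDim R V ≤ Module.supportDim R W :=
  Order.krullDim_le_of_strictMono (fun a => ⟨a.1, h a.2⟩) fun {_ _} lt => lt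

/-- Right exactness of `X ⊗ -`. It turns the case `i = 0` of the second claim into an equality. -/
theorem nonempty_chainHomology_zero_equiv {S : Type*} [CommRing S] {X : Type*} [AddCommGroup X]
    [Module S X] {P : ℕ → Type*} [∀ i, AddCommGroup (P i)] [∀ i, Module S (P i)] {L : Type*}
    [AddCommGroup L] [Module S L] {dP : ∀ i, P (i + 1) →ₗ[S] P i} {ε : P 0 →ₗ[S] L}
    (h0 : Function.Exact (dP 0) ε) (hε : Function.Surjective ε) :
    Nonempty
      (chainHomology (C := fun i => X ⊗[S] P i) (tensorComplex S X dP) 0 ≃ₗ[S] X ⊗[S] L) := by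
  let φ : chainCycles (C := fun i => X ⊗[S] P i) (tensorComplex S X dP) 0 →ₗ[S] X ⊗[S] L :=
    (ε.lTensor X).comp (Submodule.subtype _)
  have hsurj : Function.Surjective φ := by
    intro z
    obtain ⟨y, rfl⟩ := LinearMap.lTensor_surjective X hε z
    exact ⟨⟨y, trivial⟩, rfl⟩
  have hker : (LinearMap.range (tensorComplex S X dP 0)).submoduleOf
      (chainCycles (C := fun i => X ⊗[S] P i) (tensorComplex S X dP) 0) = LinearMap.ker φ := by
    ext z
    exact (lTensor_exact X h0 hε z.1).symm
  exact ⟨(Submodule.quotEquivOfEq _ _ hker).trans (φ.quotKerEquivOfSurjective hsurj)⟩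

theorem iteratedHilbert_congr {K : Type*} [Field K] {X Y : Type*} [AddCommGroup X] [Module K X]
    [AddCommGroup Y] [Module K Y] {𝒳 : ℤ → Submodule K X} {𝒴 : ℤ → Submodule K Y}
    (h : ∀ c, Module.finrank K (𝒳 c) = Module.finrank K (𝒴 c)) (j : ℕ) :
    iteratedHilbert 𝒳 j = iteratedHilbert 𝒴 j := by
  induction j with
  | zero => exact funext h
  | succ j ih =>
    funext t
    rw [iteratedHilbert, iteratedHilbert, ih]

theorem finrank_comap_component {K : Type*} [Field K] {n : ℕ} {V : Type*} [AddCommGroup V]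
    [Module K V] [Module (PolyX K n) V] [IsScalarTower K (PolyX K n) V] (𝒱 : ℤ × ℤ → Submodule K V)
    (c k : ℤ) :
    Module.finrank K ((𝒱 (c, k)).comap ((component n 𝒱 k).subtype.restrictScalars K)) =
      Module.finrank K (𝒱 (c, k)) :=
  LinearEquiv.finrank_eq
    { toFun := fun x => ⟨x.1.1, x.2⟩
      invFun := fun x => ⟨⟨x.1, Submodule.subset_span (Set.mem_iUnion.2 ⟨c, x.2⟩)⟩, x.2⟩
      map_add' := fun _ _ => rfl
      map_smul' := fun _ _ => rfl
      left_inv := fun _ => rfl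
      right_inv := fun _ => rfl }

theorem IsGradedX.raisesDegree_component {K : Type*} [Field K] {n : ℕ} {V : Type*}
    [AddCommGroup V] [Module K V] [Module (PolyX K n) V] [IsScalarTower K (PolyX K n) V]
    {𝒱 : ℤ × ℤ → Submodule K V} (h : IsGradedX (n := n) 𝒱) (k : ℤ) :
    RaisesDegree n
      (fun c : ℤ => (𝒱 (c, k)).comap ((component n 𝒱 k).subtype.restrictScalars K)) := by
  intro i c v hv
  have := h 1 (c, k) (MvPolynomial.X i) (MvPolynomial.isWeightedHomogeneous_X K _ i) v hv
  rwa [Prod.mk_add_mk, zero_add, add_comm] at this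

end GradedTor

end

open GradedTor in
theorem proposition3p3
    {K : Type*} [Field K] {n m : ℕ} (p : Fin m → ℕ)
    -- a finitely generated graded `S`-module `M`
    {M : Type*} [AddCommGroup M] [Module K M] [Module (PolyX K n) M]
    [IsScalarTower K (PolyX K n) M] [Module.Finite (PolyX K n) M]
    (ℳ : ℤ → Submodule K M) [DirectSum.Decomposition ℳ] [SetLike.GradedSMul (gradingX K n) ℳ]
    -- a finitely generated bigraded `A`-module `N`
    {N : Type*} [AddCommGroup N] [Module K N] [Module (PolyX K n) N] [Module (PolyXY K n m) N]
    [IsScalarTower K (PolyXY K n m) N] [IsScalarTower (PolyX K n) (PolyXY K n m) N]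
    [Module.Finite (PolyXY K n m) N]
    (𝒩 : ℤ × ℤ → Submodule K N) [DirectSum.Decomposition 𝒩]
    [SetLike.GradedSMul (gradingXY K n p) 𝒩]
    -- a bigraded free resolution of `N`, by which `Tor_i^S(M, N)` is computed
    (F : BigradedFreeResolution n p 𝒩) :
    (∀ (i : ℕ) (k : ℤ),
      Module.supportDim (PolyX K n) (F.torComponent ℳ (i + 1) k) ≤
        Module.supportDim (PolyX K n) (F.torComponent ℳ i k)) ∧
    (∀ (i : ℕ) (k : ℤ),
      Module.supportDim (PolyX K n) (F.torComponent ℳ i k) ≤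
        Module.supportDim (PolyX K n) (TensorProduct (PolyX K n) M (component n 𝒩 k))) ∧
    ∃ d : WithBot ℕ∞,
      (∀ᶠ k : ℤ in Filter.atTop,
        Module.supportDim (PolyX K n) (TensorProduct (PolyX K n) M (component n 𝒩 k)) = d) ∧
      ∀ᶠ k : ℤ in Filter.atTop, ∀ i j : ℕ, ∃ P : Polynomial ℚ,
        IsIteratedHilbertPolynomial (fun c : ℤ => F.torGrading ℳ i (c, k)) j P ∧
        P.degree.map (fun r : ℕ => (r : ℕ∞)) + 1 ≤ d + (j : WithBot ℕ∞) := by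
  have μ : Parts ℳ := Parts.ofDecomposition ℳ
  have ν : Parts 𝒩 := Parts.ofDecomposition 𝒩
  have hℳ : ∀ a b, ∀ s ∈ gradingX K n a, ∀ u ∈ ℳ b, s • u ∈ ℳ (a + b) :=
    fun _ _ _ hs _ hu => SetLike.GradedSMul.smul_mem hs hu
  have h𝒩 : IsGradedX (n := n) 𝒩 := isGradedX_of_gradedSMul (p := p) 𝒩
  have hfin := (exists_generates_component (n := n) (p := p) 𝒩).1
  have hrigid : ∀ k, HasRigidTensor (PolyX K n) M
      (P := fun i => component n (freeGrading (K := K) (n := n) p (F.deg i)) k)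
      (F.dComponent k) := fun k => by
    have := hfin k
    have := fun i => flat_component_freeGrading (K := K) (n := n) (p := p) (F.deg i) k
    exact hasRigidTensor_mvPolynomial
      (P := fun i => component n (freeGrading (K := K) (n := n) p (F.deg i)) k)
      (F.exact_dComponent k) (F.exact_augComponent k)
      (F.augComponent_surjective k ν h𝒩)
  have e := fun i k => (F.exists_equiv_torComponent k μ hℳ i).2.some
  have hstep : ∀ (i : ℕ) (k : ℤ), Module.supportDim (PolyX K n) (F.torComponent ℳ (i + 1) k) ≤
      Module.supportDim (PolyX K n) (F.torComponent ℳ i k) := fun i k => by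
    rw [← Module.supportDim_eq_of_equiv (e (i + 1) k), ← Module.supportDim_eq_of_equiv (e i k)]
    exact supportDim_le_of_support_subset ((hrigid k).2.support_subset (hrigid k).1 i)
  have hle : ∀ (i : ℕ) (k : ℤ), Module.supportDim (PolyX K n) (F.torComponent ℳ i k) ≤
      Module.supportDim (PolyX K n) (M ⊗[PolyX K n] component n 𝒩 k) := fun i k => by
    induction i with
    | zero =>
      obtain ⟨e₀⟩ := nonempty_chainHomology_zero_equiv (X := M)
        (P := fun i => component n (freeGrading (K := K) (n := n) p (F.deg i)) k)
        (F.exact_augComponent k)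
        (F.augComponent_surjective k ν h𝒩)
      exact (Module.supportDim_eq_of_equiv ((e 0 k).symm.trans e₀)).le
    | succ i ih => exact (hstep i k).trans ih
  refine ⟨hstep, hle, ?_⟩
  obtain ⟨d, hd⟩ := exists_supportDim_tensor_component_eq (n := n) (p := p) 𝒩 M
  -- The only condition on `k` is that `M ⊗ N_k` has its stable dimension, so one threshold serves
  -- all `i` and `j`.
  refine ⟨d, hd, hd.mono fun k hk i j => ?_⟩
  have τ : Parts (F.torGrading ℳ i) := (F.exists_equiv_torComponent k μ hℳ i).1.some
  have hτ : IsGradedX (n := n) (F.torGrading ℳ i) :=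
    (F.isGradedX_tensorGrading hℳ i).subquotient (F.cycles M i) (F.boundaries M i)
  obtain ⟨σ⟩ := τ.exists_component hτ k
  have : Module.Finite (PolyX K n) (F.torComponent ℳ i k) := by
    have := (hrigid k).1.finite i
    exact Module.Finite.equiv (e i k)
  have : Module.Finite (PolyX K n) (component n (F.torGrading ℳ i) k) := this
  obtain ⟨P, hP, hdeg⟩ := exists_isIteratedHilbertPolynomial σ (hτ.raisesDegree_component k)
    ((hle i k).trans_eq hk) j
  refine ⟨P, ?_, hdeg⟩
  rw [IsIteratedHilbertPolynomial, iteratedHilbert_congr fun c =>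
    (finrank_comap_component (F.torGrading ℳ i) c k)] at hP
  exact hP
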